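/- **Setting.** Let $A$ be a real $n\times m$ matrix with columns $A_j$, let $\sigma_{obs},\sigma_{sys}\ge 0$ and $\lambda_m=\sqrt{2\log m}$. Let $\delta_S$ be the smallest $\delta\ge0$ with $(1-\delta)\|c\|^2\le\|Ac\|^2\le(1+\delta)\|c\|^2$ for all $S$-sparse $c\in\mathbb R^m$, and let $\theta_{S,S'}$ be the smallest $\theta\ge0$ with $|\langle Ac,Ac'\rangle|\le\theta\|c\|\|c'\|$ for all disjointly supported $S$-sparse $c$ and $S'$-sparse $c'$. Let $N_0\subseteq N_1\subseteq\cdots$ be non-random subsets of $\{1,\dots,m\}$, and let $$x_0=0,\qquad x_t=x_{t-1}+\nu_t,\qquad y_t=Ax_t+w_t\qquad(t\ge1),$$ where $\nu_t\sim\mathcal N(0,\sigma_{sys}^2I_{N_t})$ ($I_{N}$ being the diagonal $0/1$ matrix with ones exactly at the indices in $N$), the $w_t$ are i.i.d. with $\mathbb E[w_t]=0$, $\mathbb E[w_tw_t']=\sigma_{obs}^2I$, and all $\nu_t$, $w_t$ are mutually independent. Let $T_t$ ($t\ge0$) be estimates of $N_t$, i.e. random subsets of $\{1,\dots,m\}$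 that are functions of $y_{1:t}=(y_1,\dots,y_t)$ ($T_0$ is non-random). **Assumption 1.** (i) Almost surely, every entry of $w_t$ has absolute value at most $\lambda_m\sigma_{obs}/\max_j\|A_j\|_1$ (no bound if $A=0$); (ii) $|N_t|\le S_{max}$ for all $t$; (iii) almost surely $|T_t\setminus N_t|\le S_{fa}$ for all $t$; (iv) $\delta_{S_{max}+S_{fa}}<1$. **Notation.** Fix $t\ge1$ and put $T=T_{t-1}$, $\Delta=N_t\setminus T$. Let $\hat x_{t,tmp}$ equal $(A_T'A_T)^{-1}A_T'y_t$ on $T$ and $0$ off $T$, and let $\beta_t=x_t-\hat x_{t,tmp}$ and $\tilde y_t=y_t-A\hat x_{t,tmp}$. Let $t_a$ be the last addition time before or at $t$: the largest $\tau\in[1,t]$ with $N_\tau\ne N_{\tau-1}$, and $t_a=1$ if there is none. The signal $\beta_t$ is called *compressible* (given the past observations) if $$\max_{i\in T}\mathbb E[(\beta_t)_i^2\mid y_{1:t-1}]<\min_{j\in N_t}\mathbb E[(x_t)_j^2],$$ which holds vacuously if $T$ or $N_t$ is empty. **Theorem 1.** Suppose Assumption 1 holds. All second moments below are finite, and the following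 holds almost surely. 1. Put $$\rho=\frac{\theta_{|T|,|\Delta|}^2}{(1-\delta_{|T|})^2}\,\lambda_{max}\big(\mathbb E[(x_t)_\Delta(x_t)_\Delta'\mid y_{1:t-1}]\big)+\frac{\sigma_{obs}^2}{1-\delta_{|T|}},$$ with $\lambda_{max}=0$ if $\Delta=\emptyset$. If $(t-t_a+1)\sigma_{sys}^2>\rho$, then $\beta_t$ is compressible. If only $(t-t_a+1)\sigma_{sys}^2\ge\rho$, then the inequality defining compressibility holds with $\le$ in place of $<$. 2. Let $\hat\beta_t$ be any (measurable) minimizer of $\|b\|_1$ over all $b$ with $\|A'(\tilde y_t-Ab)\|_\infty\le\lambda_m\sigma_{obs}$, and let $\hat x_{t,CSLSE}=\hat x_{t,tmp}+\hat\beta_t$. Let $S_\infty$ be the largest integer $S\le m$ with $\delta_{2S}+\theta_{S,2S}<1$. Then $$\mathbb E\big[\|x_t-\hat x_{t,CSLSE}\|^2\mid y_{1:t-1}\big]\le\min_{1\le S\le S_\infty}B_{CSLSE}(S),$$ $$B_{CSLSE}(S)=C_2(S)\,S\,\sigma_{obs}^2+C_3(S)\,\frac{(|T|+|\Delta|-S)_+}{S}\,L_0(S),$$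 where $(a)_+=\max(a,0)$, a minimum over the empty set is $+\infty$, and $$C_2(S)=\frac{48\,\lambda_m^2}{(1-\delta_{2S}-\theta_{S,2S})^2},\qquad C_3(S)=8+\frac{24\,\theta_{S,2S}^2}{(1-\delta_{2S}-\theta_{S,2S})^2},$$ $$L_0(S)=\begin{cases}\dfrac{\theta_{|T|,|\Delta|}^2}{(1-\delta_{|T|})^2}\,\mathbb E[\|(x_t)_\Delta\|^2\mid y_{1:t-1}]+(|T|+|\Delta|-S)_+\dfrac{\sigma_{obs}^2}{1-\delta_{|T|}}&\text{if }S\ge|\Delta|,\\[2ex]\Big(\dfrac{\theta_{|T|,|\Delta|}^2}{(1-\delta_{|T|})^2}+1\Big)\mathbb E[\|(x_t)_\Delta\|^2\mid y_{1:t-1}]+|T|\dfrac{\sigma_{obs}^2}{1-\delta_{|T|}}&\text{if }S<|\Delta|.\end{cases}$$ -/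

import Mathlib

open MeasureTheory ProbabilityTheory
open scoped Matrix

noncomputable section

namespace LSCS

/-- Squared Euclidean norm. -/
def sqNorm {ι : Type*} [Fintype ι] (v : ι → ℝ) : ℝ := ∑ i, v i ^ 2

/-- The `ℓ¹` norm. -/
def l1Norm {ι : Type*} [Fintype ι] (v : ι → ℝ) : ℝ := ∑ i, |v i|

/-- The support of a vector of `ℝ^m`. -/
def supp {m : ℕ} (c : Fin m → ℝ) : Finset (Fin m) := Finset.univ.filter fun i => c i ≠ 0

/-- The `S`-restricted isometry constant `δ_S` of `A`: the smallest `δ ≥ 0` such that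
`(1 - δ) ‖c‖² ≤ ‖A c‖² ≤ (1 + δ) ‖c‖²` for every `c` with at most `S` nonzero entries. -/
def ricDelta {m n : ℕ} (A : Matrix (Fin n) (Fin m) ℝ) (S : ℕ) : ℝ :=
  sInf {δ : ℝ | 0 ≤ δ ∧ ∀ c : Fin m → ℝ, (supp c).card ≤ S →
    (1 - δ) * sqNorm c ≤ sqNorm (A *ᵥ c) ∧ sqNorm (A *ᵥ c) ≤ (1 + δ) * sqNorm c}

/-- The `S,S'`-restricted orthogonality constant `θ_{S,S'}` of `A`: the smallest `θ ≥ 0` such that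
`|⟨A c, A c'⟩| ≤ θ ‖c‖ ‖c'‖` for all disjointly supported `c`, `c'` with at most `S`,
respectively `S'`, nonzero entries. -/
def rocTheta {m n : ℕ} (A : Matrix (Fin n) (Fin m) ℝ) (S S' : ℕ) : ℝ :=
  sInf {θ : ℝ | 0 ≤ θ ∧ ∀ c c' : Fin m → ℝ, (supp c).card ≤ S → (supp c').card ≤ S' →
    Disjoint (supp c) (supp c') →
      |(A *ᵥ c) ⬝ᵥ (A *ᵥ c')| ≤ θ * (√(sqNorm c) * √(sqNorm c'))}

/-- `λ_m = √(2 log m)`. -/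
def lam (m : ℕ) : ℝ := √(2 * Real.log m)

/-- The largest eigenvalue of a real symmetric matrix (`0` for the empty matrix). -/
def lambdaMax {ι : Type*} [Fintype ι] [DecidableEq ι] (M : Matrix ι ι ℝ) : ℝ :=
  sSup (spectrum ℝ M)

/-- The submatrix `A_T` of the columns of `A` with index in `T`. -/
def colSub {m n : ℕ} (A : Matrix (Fin n) (Fin m) ℝ) (T : Finset (Fin m)) :
    Matrix (Fin n) T ℝ :=
  A.submatrix id Subtype.val

/-- The least squares estimate supported on `T`: equal to `(A_T' A_T)⁻¹ A_T' y` on `T` and to `0`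
outside `T`. -/
def lsEst {m n : ℕ} (A : Matrix (Fin n) (Fin m) ℝ) (T : Finset (Fin m)) (y : Fin n → ℝ) :
    Fin m → ℝ := fun i =>
  if h : i ∈ T then
    (((colSub A T)ᵀ * colSub A T)⁻¹ *ᵥ ((colSub A T)ᵀ *ᵥ y)) ⟨i, h⟩
  else 0

/-- Feasibility for the Dantzig selector: `‖A' (r - A b)‖_∞ ≤ κ`. -/
def DantzigFeasible {m n : ℕ} (A : Matrix (Fin n) (Fin m) ℝ) (κ : ℝ) (r : Fin n → ℝ)
    (b : Fin m → ℝ) : Prop :=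
  ∀ j, |(Aᵀ *ᵥ (r - A *ᵥ b)) j| ≤ κ

/-- `b` is an output of the Dantzig selector applied to `r`:
`b ∈ argmin ‖b'‖₁` subject to `‖A' (r - A b')‖_∞ ≤ κ`. -/
def IsDantzigSelector {m n : ℕ} (A : Matrix (Fin n) (Fin m) ℝ) (κ : ℝ) (r : Fin n → ℝ)
    (b : Fin m → ℝ) : Prop :=
  DantzigFeasible A κ r b ∧ ∀ b', DantzigFeasible A κ r b' → l1Norm b ≤ l1Norm b'

/-- The `σ`-algebra generated by the observations `y_1, …, y_k`. -/
abbrev obsSigma {Ω : Type*} {n : ℕ} (y : ℕ → Ω → Fin n → ℝ) (k : ℕ) : MeasurableSpace Ω :=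
  ⨆ s ∈ Finset.Icc 1 k, MeasurableSpace.comap (y s) inferInstance

/-- The state/observation model and the standing assumptions. The state `x` starts at `0` and
performs a Gaussian random walk with increments `ν_t ~ N(0, σ_sys² I_{N_t})`, `t ≥ 1`; the
observations are `y_t = A x_t + w_t`, `t ≥ 1`, with zero-mean white i.i.d. bounded noise. All
noises are independent. The (non-random) sets `N_t` are increasing, the support estimates `T_t`
are functions of `y_1, …, y_t`, and the number of false additions is bounded. -/
structure Model {m n : ℕ} (A : Matrix (Fin n) (Fin m) ℝ) (σobs σsys : ℝ) (Smax Sfa : ℕ)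
    (N : ℕ → Finset (Fin m)) {Ω : Type*} [MeasurableSpace Ω] (μ : Measure Ω)
    (x ν : ℕ → Ω → Fin m → ℝ) (y w : ℕ → Ω → Fin n → ℝ) (T : ℕ → Ω → Finset (Fin m)) :
    Prop where
  σobs_nonneg : 0 ≤ σobs
  -- system model
  x_zero : ∀ ω, x 0 ω = 0
  x_succ : ∀ t ω, x (t + 1) ω = x t ω + ν (t + 1) ω
  ν_meas : ∀ t, Measurable (ν (t + 1))
  -- `N(0, σ_sys² I_{N_t})`: independent coordinates, of variance `σ_sys²` on `N_t`, `0` off `N_t`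
  ν_law : ∀ t, μ.map (ν (t + 1)) =
    Measure.pi fun i => gaussianReal 0 (if i ∈ N (t + 1) then (σsys ^ 2).toNNReal else 0)
  -- observation model
  y_eq : ∀ t ω, y (t + 1) ω = A *ᵥ x (t + 1) ω + w (t + 1) ω
  w_meas : ∀ t, Measurable (w (t + 1))
  w_ident : ∀ t, IdentDistrib (w (t + 1)) (w 1) μ μ
  w_memLp : ∀ t k, MemLp (fun ω => w (t + 1) ω k) 2 μ
  w_mean : ∀ t k, ∫ ω, w (t + 1) ω k ∂μ = 0
  w_cov : ∀ t k l, ∫ ω, w (t + 1) ω k * w (t + 1) ω l ∂μ = if k = l then σobs ^ 2 else 0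
  -- `w_t` and `ν_t` are independent over time and of each other
  ν_indep : iIndepFun (fun t => ν (t + 1)) μ
  w_indep : iIndepFun (fun t => w (t + 1)) μ
  ν_w_indep : IndepFun (fun ω t => ν (t + 1) ω) (fun ω t => w (t + 1) ω) μ
  -- `|w_{t,k}| ≤ λ_m σ_obs / max_j ‖A_j‖₁`, written without a division
  w_bdd : ∀ t, ∀ᵐ ω ∂μ, ∀ k j, |w (t + 1) ω k| * l1Norm (fun l => A l j) ≤ lam m * σobs
  -- supports
  N_mono : ∀ t, N t ⊆ N (t + 1)
  N_card : ∀ t, (N t).card ≤ Smax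
  -- support estimates
  T_adapted : ∀ t U, MeasurableSet[obsSigma y t] {ω | T t ω = U}
  T_false : ∀ t, ∀ᵐ ω ∂μ, (T t ω \ N t).card ≤ Sfa
  -- incoherence
  delta_lt : ricDelta A (Smax + Sfa) < 1

/-- The last addition time `t_a` before or at `t`, i.e. the last `τ ∈ [1, t]` with
`N_{τ-1} ≠ N_τ` (coordinates that are present from the start count as added at time `1`). -/
def lastAdd {m : ℕ} (N : ℕ → Finset (Fin m)) (t : ℕ) : ℕ :=
  max 1 (Nat.findGreatest (fun τ => 1 ≤ τ ∧ N (τ - 1) ≠ N τ) t)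

/-- Undetected set `Δ_t = N_t \ T_{t-1}`. -/
def undet {m : ℕ} {Ω : Type*} (N : ℕ → Finset (Fin m)) (T : ℕ → Ω → Finset (Fin m)) (t : ℕ)
    (ω : Ω) : Finset (Fin m) :=
  N t \ T (t - 1) ω

/-- `x̂_{t,tmp}`, the least squares estimate of `x_t` on `T_{t-1}`. -/
def xTmp {m n : ℕ} {Ω : Type*} (A : Matrix (Fin n) (Fin m) ℝ) (y : ℕ → Ω → Fin n → ℝ)
    (T : ℕ → Ω → Finset (Fin m)) (t : ℕ) (ω : Ω) : Fin m → ℝ :=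
  lsEst A (T (t - 1) ω) (y t ω)

/-- The least squares residual `ỹ_{t,res} = y_t - A x̂_{t,tmp}`. -/
def yRes {m n : ℕ} {Ω : Type*} (A : Matrix (Fin n) (Fin m) ℝ) (y : ℕ → Ω → Fin n → ℝ)
    (T : ℕ → Ω → Finset (Fin m)) (t : ℕ) (ω : Ω) : Fin n → ℝ :=
  y t ω - A *ᵥ xTmp A y T t ω

/-- The residual signal `β_t = x_t - x̂_{t,tmp}`. -/
def resid {m n : ℕ} {Ω : Type*} (A : Matrix (Fin n) (Fin m) ℝ) (x : ℕ → Ω → Fin m → ℝ)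
    (y : ℕ → Ω → Fin n → ℝ) (T : ℕ → Ω → Finset (Fin m)) (t : ℕ) (ω : Ω) : Fin m → ℝ :=
  x t ω - xTmp A y T t ω

/-- `E[(β_t)_i² | y_{1:t-1}]`. -/
def condSqResid {m n : ℕ} {Ω : Type*} [MeasurableSpace Ω] (A : Matrix (Fin n) (Fin m) ℝ)
    (μ : Measure Ω) (x : ℕ → Ω → Fin m → ℝ) (y : ℕ → Ω → Fin n → ℝ)
    (T : ℕ → Ω → Finset (Fin m)) (t : ℕ) (i : Fin m) : Ω → ℝ :=
  μ[fun ω => resid A x y T t ω i ^ 2 | obsSigma y (t - 1)]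

/-- `β_t` is compressible, given the past observations (seen at the outcome `ω`):
`max_{i ∈ T} E[(β_t)_i² | y_{1:t-1}] < min_{j ∈ N_t} E[(x_t)_j²]`, `T = T_{t-1}`. -/
def CompressibleAt {m n : ℕ} {Ω : Type*} [MeasurableSpace Ω] (A : Matrix (Fin n) (Fin m) ℝ)
    (N : ℕ → Finset (Fin m)) (μ : Measure Ω) (x : ℕ → Ω → Fin m → ℝ)
    (y : ℕ → Ω → Fin n → ℝ) (T : ℕ → Ω → Finset (Fin m)) (t : ℕ) (ω : Ω) : Prop :=
  ∀ i ∈ T (t - 1) ω, ∀ j ∈ N t, condSqResid A μ x y T t i ω < ∫ ω', x t ω' j ^ 2 ∂μ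

/-- The same comparison with a non-strict inequality. -/
def WeaklyCompressibleAt {m n : ℕ} {Ω : Type*} [MeasurableSpace Ω]
    (A : Matrix (Fin n) (Fin m) ℝ)
    (N : ℕ → Finset (Fin m)) (μ : Measure Ω) (x : ℕ → Ω → Fin m → ℝ)
    (y : ℕ → Ω → Fin n → ℝ) (T : ℕ → Ω → Finset (Fin m)) (t : ℕ) (ω : Ω) : Prop :=
  ∀ i ∈ T (t - 1) ω, ∀ j ∈ N t, condSqResid A μ x y T t i ω ≤ ∫ ω', x t ω' j ^ 2 ∂μ

/-- `E[(x_t)_Δ (x_t)_Δ' | y_{1:t-1}]` at the outcome `ω`, a matrix indexed by `Δ = Δ_t(ω)`. -/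
def condSecondMoment {m n : ℕ} {Ω : Type*} [MeasurableSpace Ω]
    (N : ℕ → Finset (Fin m)) (μ : Measure Ω) (x : ℕ → Ω → Fin m → ℝ)
    (y : ℕ → Ω → Fin n → ℝ) (T : ℕ → Ω → Finset (Fin m)) (t : ℕ) (ω : Ω) :
    Matrix (undet N T t ω) (undet N T t ω) ℝ :=
  Matrix.of fun i j => (μ[fun ω' => x t ω' i * x t ω' j | obsSigma y (t - 1)]) ω

/-- `E[‖(x_t)_Δ‖² | y_{1:t-1}]`. -/
def condSqUndet {m n : ℕ} {Ω : Type*} [MeasurableSpace Ω]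
    (N : ℕ → Finset (Fin m)) (μ : Measure Ω) (x : ℕ → Ω → Fin m → ℝ)
    (y : ℕ → Ω → Fin n → ℝ) (T : ℕ → Ω → Finset (Fin m)) (t : ℕ) : Ω → ℝ :=
  μ[fun ω => ∑ i ∈ undet N T t ω, x t ω i ^ 2 | obsSigma y (t - 1)]

/-- The threshold
`θ_{|T|,|Δ|}² / (1 - δ_{|T|})² · λ_max(E[(x_t)_Δ (x_t)_Δ' | y_{1:t-1}]) + σ_obs² / (1 - δ_{|T|})`,
at the outcome `ω`. -/
def threshold {m n : ℕ} {Ω : Type*} [MeasurableSpace Ω] (A : Matrix (Fin n) (Fin m) ℝ) (σobs : ℝ)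
    (N : ℕ → Finset (Fin m)) (μ : Measure Ω) (x : ℕ → Ω → Fin m → ℝ)
    (y : ℕ → Ω → Fin n → ℝ) (T : ℕ → Ω → Finset (Fin m)) (t : ℕ) (ω : Ω) : ℝ :=
  rocTheta A (T (t - 1) ω).card (undet N T t ω).card ^ 2
      / (1 - ricDelta A (T (t - 1) ω).card) ^ 2
      * lambdaMax (condSecondMoment N μ x y T t ω)
    + σobs ^ 2 / (1 - ricDelta A (T (t - 1) ω).card)

/-- `S_∞`, the largest sparsity level `S ≤ m` with `δ_{2S} + θ_{S,2S} < 1`. -/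
def SInfty {m n : ℕ} (A : Matrix (Fin n) (Fin m) ℝ) : ℕ :=
  sSup {S : ℕ | S ≤ m ∧ ricDelta A (2 * S) + rocTheta A S (2 * S) < 1}

/-- `C_2(S) = 48 λ_m² / (1 - δ_{2S} - θ_{S,2S})²`. -/
def C2 {m n : ℕ} (A : Matrix (Fin n) (Fin m) ℝ) (S : ℕ) : ℝ :=
  48 * lam m ^ 2 / (1 - ricDelta A (2 * S) - rocTheta A S (2 * S)) ^ 2

/-- `C_3(S) = 8 + 24 θ_{S,2S}² / (1 - δ_{2S} - θ_{S,2S})²`. -/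
def C3 {m n : ℕ} (A : Matrix (Fin n) (Fin m) ℝ) (S : ℕ) : ℝ :=
  8 + 24 * rocTheta A S (2 * S) ^ 2 / (1 - ricDelta A (2 * S) - rocTheta A S (2 * S)) ^ 2

/-- The quantity `L0`, for `a = |T|`, `d = |Δ|` and `e = E[‖(x_t)_Δ‖² | y_{1:t-1}]`. The
subtraction of natural numbers is the positive part `(a + d - S)₊`. -/
def L0 {m n : ℕ} (A : Matrix (Fin n) (Fin m) ℝ) (σobs : ℝ) (a d : ℕ) (e : ℝ) (S : ℕ) : ℝ :=
  if d ≤ S then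
    rocTheta A a d ^ 2 / (1 - ricDelta A a) ^ 2 * e
      + ((a + d - S : ℕ) : ℝ) * (σobs ^ 2 / (1 - ricDelta A a))
  else
    (rocTheta A a d ^ 2 / (1 - ricDelta A a) ^ 2 + 1) * e
      + (a : ℝ) * (σobs ^ 2 / (1 - ricDelta A a))

/-- The bound `B_CSLSE(S)`, for `a = |T|`, `d = |Δ|` and `e = E[‖(x_t)_Δ‖² | y_{1:t-1}]`. The
subtraction of natural numbers is the positive part `(a + d - S)₊`. -/
def BCSLSE {m n : ℕ} (A : Matrix (Fin n) (Fin m) ℝ) (σobs : ℝ) (a d : ℕ) (e : ℝ) (S : ℕ) : ℝ :=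
  C2 A S * S * σobs ^ 2 + C3 A S * (((a + d - S : ℕ) : ℝ) / S) * L0 A σobs a d e S

end LSCS

end

/-!
The theorem has a probabilistic half, a bound for the least squares residual `β_t` given the past
observations, and a deterministic half, a bound for the Dantzig selector on vectors that are only
approximately sparse.

*The residual.* Fix the support estimate to be a set `U` with `δ_{|U|} < 1` and put `Δ = N_t \ U`.
As `x_t` is supported on `N_t`, the normal equations give `β_t = x_t` off `U`, and on `U` they
leave `(β_t)_i = -(q_i · x_t + r_i · w_t)`, where `r_i` is the row of the least squares matrix and
`q_i` is the row of its product with `A_Δ` (`residual_apply_of_mem`). Testing the least squares map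
on the rows themselves gives `‖r_i‖² ≤ 1 / (1 - δ)` and `‖q_i‖² ≤ θ² / (1 - δ)²`. The noise `w_t` is
independent of a `σ`-algebra that contains `y_{1:t-1}` and determines `x_t`
(`Model.indep_history`), so the conditional second moment of `(β_t)_i` is that of `q_i · x_t` plus
`σ_obs² ‖r_i‖²` (`condExp_add_sq_of_indep`). The first term is a quadratic form in the conditional
second moment matrix, whence the eigenvalue in the threshold; summed over `i` it is at most
`θ² / (1 - δ)² · ‖x_Δ‖²`, whence `L0`. A coordinate in `N_t` has received an increment at every
time since the last addition, which bounds `E[(x_t)_j²]` from below (`Model.le_integral_x_sq`).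
The estimate `T_{t-1}` takes finitely many values, each on an event determined by `y_{1:t-1}`, and
conditional expectations can be compared on such events (`condExp_le_condExp_on`), so that it may
be treated as the constant `U`.

*The Dantzig selector.* Let `h` be the difference of two feasible vectors, `F` a set of at most `S`
indices, and `u` the norm of `h` on `F` and on the `S` largest entries off `F`. Cutting the rest
into blocks of decreasing magnitude bounds `u` by the constraint and by `‖h_{Fᶜ}‖₁ / √S`, and also bounds
the energy of `h` outside the core by `‖h_{Fᶜ}‖₁² / S` (`exists_core_bound`). Minimality
of the `ℓ¹` norm bounds `‖h_{Fᶜ}‖₁` by `√S u + 2 ‖β_{Fᶜ}‖₁`, and eliminating `u` gives the constants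
`C2` and `C3` (`sqNorm_sub_dantzig_le`). The set `F` need not carry the largest entries of `β_t`: it
is chosen as a function of `U` so that the conditional energy of `β_t` off `F` is at most `L0`
(`Model.exists_index_set`), and Cauchy-Schwarz passes from the `ℓ¹` norm to this energy.
-/

open MeasureTheory ProbabilityTheory
open scoped Matrix

noncomputable section
namespace LSCS
variable {m n : ℕ}

/-! ### Norms and restrictions of vectors -/

theorem sqNorm_nonneg {ι : Type*} [Fintype ι] (v : ι → ℝ) : 0 ≤ sqNorm v :=
  Finset.sum_nonneg fun _ _ => sq_nonneg _

theorem l1Norm_nonneg {ι : Type*} [Fintype ι] (v : ι → ℝ) : 0 ≤ l1Norm v :=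
  Finset.sum_nonneg fun _ _ => abs_nonneg _

theorem dotProduct_self_eq_sqNorm {ι : Type*} [Fintype ι] (v : ι → ℝ) : v ⬝ᵥ v = sqNorm v := by
  simp [dotProduct, sqNorm, sq]

theorem sq_dotProduct_le {ι : Type*} [Fintype ι] (u v : ι → ℝ) :
    (u ⬝ᵥ v) ^ 2 ≤ sqNorm u * sqNorm v :=
  Finset.sum_mul_sq_le_sq_mul_sq _ _ _

theorem abs_dotProduct_le {ι : Type*} [Fintype ι] (u v : ι → ℝ) :
    |u ⬝ᵥ v| ≤ √(sqNorm u) * √(sqNorm v) := by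
  rw [← Real.sqrt_mul (sqNorm_nonneg u), ← Real.sqrt_sq_eq_abs]
  exact Real.sqrt_le_sqrt (sq_dotProduct_le u v)

theorem mulVec_dotProduct_eq (A : Matrix (Fin n) (Fin m) ℝ) (u : Fin m → ℝ) (z : Fin n → ℝ) :
    (A *ᵥ u) ⬝ᵥ z = u ⬝ᵥ (Aᵀ *ᵥ z) := by
  rw [Matrix.mulVec_transpose, dotProduct_comm, Matrix.dotProduct_mulVec, dotProduct_comm]

/-- The vector that agrees with `h` on `E` and vanishes off `E`. -/
def trunc (E : Finset (Fin m)) (h : Fin m → ℝ) : Fin m → ℝ := fun i => if i ∈ E then h i else 0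

theorem supp_trunc_subset (E : Finset (Fin m)) (h : Fin m → ℝ) : supp (trunc E h) ⊆ E := by
  intro i hi
  by_contra hn
  exact (Finset.mem_filter.1 hi).2 (if_neg hn)

theorem card_supp_trunc_le (E : Finset (Fin m)) (h : Fin m → ℝ) :
    (supp (trunc E h)).card ≤ E.card :=
  Finset.card_le_card (supp_trunc_subset E h)

theorem sqNorm_trunc (E : Finset (Fin m)) (h : Fin m → ℝ) :
    sqNorm (trunc E h) = ∑ i ∈ E, h i ^ 2 := by
  simp [sqNorm, trunc, ite_pow, Finset.sum_ite_mem]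

theorem l1Norm_trunc (E : Finset (Fin m)) (h : Fin m → ℝ) :
    l1Norm (trunc E h) = ∑ i ∈ E, |h i| := by
  have : ∀ i, |trunc E h i| = if i ∈ E then |h i| else 0 := fun i => by
    unfold trunc; split_ifs <;> simp
  simp [l1Norm, this, Finset.sum_ite_mem]

theorem trunc_add_trunc_sdiff {E G : Finset (Fin m)} (hG : G ⊆ E) (h : Fin m → ℝ) :
    trunc G h + trunc (E \ G) h = trunc E h := by
  ext i
  simp only [trunc, Pi.add_apply, Finset.mem_sdiff]
  by_cases h1 : i ∈ G
  · simp [h1, hG h1]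
  · by_cases h2 : i ∈ E <;> simp [h1, h2]

theorem trunc_eq_self {E : Finset (Fin m)} {h : Fin m → ℝ} (hE : ∀ i ∉ E, h i = 0) :
    trunc E h = h := by
  ext i
  unfold trunc
  split_ifs with hi
  · rfl
  · exact (hE i hi).symm

theorem sum_abs_sq_le (E : Finset (Fin m)) (h : Fin m → ℝ) :
    (∑ i ∈ E, |h i|) ^ 2 ≤ E.card * ∑ i ∈ E, h i ^ 2 := by
  simpa using sq_sum_le_card_mul_sum_sq (s := E) (f := fun i => |h i|)

/-! ### Restricted isometry and restricted orthogonality constants -/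

theorem sqNorm_mulVec_le (A : Matrix (Fin n) (Fin m) ℝ) (c : Fin m → ℝ) :
    sqNorm (A *ᵥ c) ≤ (∑ i, sqNorm (A i)) * sqNorm c := by
  rw [Finset.sum_mul]
  exact Finset.sum_le_sum fun i _ => sq_dotProduct_le (A i) c

theorem ricDelta_mem (A : Matrix (Fin n) (Fin m) ℝ) (S : ℕ) :
    ricDelta A S ∈ {δ : ℝ | 0 ≤ δ ∧ ∀ c : Fin m → ℝ, (supp c).card ≤ S →
      (1 - δ) * sqNorm c ≤ sqNorm (A *ᵥ c) ∧ sqNorm (A *ᵥ c) ≤ (1 + δ) * sqNorm c} := by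
  refine IsClosed.csInf_mem ?_ ?_ ⟨0, fun δ h => h.1⟩
  · simp only [Set.ofPred_and, Set.ofPred_forall]
    refine (isClosed_le continuous_const continuous_id).inter
      (isClosed_iInter fun c => isClosed_iInter fun _ => ?_)
    exact (isClosed_le (by fun_prop) (by fun_prop)).inter (isClosed_le (by fun_prop) (by fun_prop))
  · have h0 : 0 ≤ ∑ i, sqNorm (A i) := Finset.sum_nonneg fun _ _ => sqNorm_nonneg _
    refine ⟨1 + ∑ i, sqNorm (A i), by positivity, fun c _ => ⟨?_, ?_⟩⟩
    · nlinarith [sqNorm_nonneg c, sqNorm_nonneg (A *ᵥ c), mul_nonneg h0 (sqNorm_nonneg c)]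
    · nlinarith [sqNorm_nonneg c, sqNorm_mulVec_le A c]

theorem rocTheta_mem (A : Matrix (Fin n) (Fin m) ℝ) (S S' : ℕ) :
    rocTheta A S S' ∈ {θ : ℝ | 0 ≤ θ ∧ ∀ c c' : Fin m → ℝ, (supp c).card ≤ S →
      (supp c').card ≤ S' → Disjoint (supp c) (supp c') →
      |(A *ᵥ c) ⬝ᵥ (A *ᵥ c')| ≤ θ * (√(sqNorm c) * √(sqNorm c'))} := by
  refine IsClosed.csInf_mem ?_ ?_ ⟨0, fun δ h => h.1⟩
  · simp only [Set.ofPred_and, Set.ofPred_forall]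
    refine (isClosed_le continuous_const continuous_id).inter
      (isClosed_iInter fun c => isClosed_iInter fun c' => isClosed_iInter fun _ =>
        isClosed_iInter fun _ => isClosed_iInter fun _ => ?_)
    exact isClosed_le (by fun_prop) (by fun_prop)
  · have h0 : 0 ≤ ∑ i, sqNorm (A i) := Finset.sum_nonneg fun _ _ => sqNorm_nonneg _
    refine ⟨∑ i, sqNorm (A i), h0, fun c c' _ _ _ => (abs_dotProduct_le _ _).trans ?_⟩
    calc √(sqNorm (A *ᵥ c)) * √(sqNorm (A *ᵥ c'))
        ≤ √((∑ i, sqNorm (A i)) * sqNorm c) * √((∑ i, sqNorm (A i)) * sqNorm c') := by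
          gcongr <;> exact sqNorm_mulVec_le A _
      _ = (∑ i, sqNorm (A i)) * (√(sqNorm c) * √(sqNorm c')) := by
          rw [Real.sqrt_mul h0, Real.sqrt_mul h0]
          linear_combination (√(sqNorm c) * √(sqNorm c')) * Real.mul_self_sqrt h0

theorem rocTheta_nonneg (A : Matrix (Fin n) (Fin m) ℝ) (S S' : ℕ) : 0 ≤ rocTheta A S S' :=
  (rocTheta_mem A S S').1

theorem ricDelta_lower (A : Matrix (Fin n) (Fin m) ℝ) {S : ℕ} {c : Fin m → ℝ}
    (hc : (supp c).card ≤ S) : (1 - ricDelta A S) * sqNorm c ≤ sqNorm (A *ᵥ c) :=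
  ((ricDelta_mem A S).2 c hc).1

theorem rocTheta_bound (A : Matrix (Fin n) (Fin m) ℝ) {S S' : ℕ} {c c' : Fin m → ℝ}
    (hc : (supp c).card ≤ S) (hc' : (supp c').card ≤ S') (hd : Disjoint (supp c) (supp c')) :
    |(A *ᵥ c) ⬝ᵥ (A *ᵥ c')| ≤ rocTheta A S S' * (√(sqNorm c) * √(sqNorm c')) :=
  (rocTheta_mem A S S').2 c c' hc hc' hd

theorem ricDelta_mono (A : Matrix (Fin n) (Fin m) ℝ) {S R : ℕ} (h : S ≤ R) :
    ricDelta A S ≤ ricDelta A R :=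
  csInf_le ⟨0, fun _ h => h.1⟩
    ⟨(ricDelta_mem A R).1, fun c hc => (ricDelta_mem A R).2 c (hc.trans h)⟩

theorem rocTheta_mono (A : Matrix (Fin n) (Fin m) ℝ) {S R S' R' : ℕ} (h : S ≤ R) (h' : S' ≤ R') :
    rocTheta A S S' ≤ rocTheta A R R' :=
  csInf_le ⟨0, fun _ h => h.1⟩ ⟨(rocTheta_mem A R R').1, fun c c' hc hc' hd =>
    (rocTheta_mem A R R').2 c c' (hc.trans h) (hc'.trans h') hd⟩

theorem incoherence_of_le_SInfty (A : Matrix (Fin n) (Fin m) ℝ) {S : ℕ}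
    (hS : S ∈ Finset.Icc 1 (SInfty A)) :
    ricDelta A (2 * S) + rocTheta A S (2 * S) < 1 := by
  rw [Finset.mem_Icc] at hS
  have hne : {S : ℕ | S ≤ m ∧ ricDelta A (2 * S) + rocTheta A S (2 * S) < 1}.Nonempty := by
    -- the supremum of the empty set of natural numbers is `0`, and `S ≥ 1` rules it out
    by_contra h
    have : SInfty A = 0 := by
      rw [SInfty, Set.not_nonempty_iff_eq_empty.1 h]; simp
    omega
  have := (Nat.sSup_mem hne ⟨m, fun _ h => h.1⟩).2
  change ricDelta A (2 * SInfty A) + rocTheta A (SInfty A) (2 * SInfty A) < 1 at this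
  have h1 := ricDelta_mono A (show 2 * S ≤ 2 * SInfty A by omega)
  have h2 := rocTheta_mono A hS.2 (show 2 * S ≤ 2 * SInfty A by omega)
  linarith

/-! ### The Dantzig selector for approximately sparse vectors -/

/-- A set of `S` indices carrying the largest entries of `h` in `E`; the entries in it and the
remaining ones are separated by the level `M`. -/
theorem exists_largest_entries (h : Fin m → ℝ) (E : Finset (Fin m)) {S : ℕ} (hS : S ≤ E.card) :
    ∃ G ⊆ E, G.card = S ∧ ∃ M, 0 ≤ M ∧ (∀ i ∈ G, M ≤ |h i|) ∧ ∀ i ∈ E \ G, |h i| ≤ M := by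
  induction S with
  | zero =>
    exact ⟨∅, by simp, by simp, ∑ i, |h i|, Finset.sum_nonneg fun _ _ => abs_nonneg _, by simp,
      fun i _ => Finset.single_le_sum (f := fun i => |h i|) (fun _ _ => abs_nonneg _)
        (Finset.mem_univ i)⟩
  | succ S ih =>
    obtain ⟨G, hGE, hG, M, -, hM1, hM2⟩ := ih (by omega)
    have hne : (E \ G).Nonempty := by
      rw [← Finset.card_pos, Finset.card_sdiff_of_subset hGE]; omega
    obtain ⟨j, hj, hjmax⟩ := Finset.exists_max_image (E \ G) (fun i => |h i|) hne
    have hj' := Finset.mem_sdiff.1 hj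
    refine ⟨insert j G, Finset.insert_subset hj'.1 hGE, by simp [hj'.2, hG], |h j|, abs_nonneg _,
      ?_, ?_⟩
    · intro i hi
      rcases Finset.mem_insert.1 hi with rfl | hi
      · exact le_rfl
      · exact (hM2 j hj).trans (hM1 i hi)
    · intro i hi
      simp only [Finset.mem_sdiff, Finset.mem_insert, not_or] at hi
      exact hjmax i (Finset.mem_sdiff.2 ⟨hi.1, hi.2.2⟩)

theorem sqrt_sqNorm_trunc_le {h : Fin m → ℝ} {E : Finset (Fin m)} {S : ℕ} (hE : E.card ≤ S) {M : ℝ}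
    (hM : 0 ≤ M) (hb : ∀ i ∈ E, |h i| ≤ M) : √(sqNorm (trunc E h)) ≤ √S * M := by
  have : sqNorm (trunc E h) ≤ S * M ^ 2 := by
    rw [sqNorm_trunc]
    calc ∑ i ∈ E, h i ^ 2 ≤ ∑ i ∈ E, M ^ 2 :=
          Finset.sum_le_sum fun i hi => sq_le_sq' (by linarith [neg_abs_le (h i), hb i hi])
            ((le_abs_self _).trans (hb i hi))
      _ = E.card * M ^ 2 := by simp
      _ ≤ S * M ^ 2 := by gcongr
  calc √(sqNorm (trunc E h)) ≤ √(S * M ^ 2) := Real.sqrt_le_sqrt this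
    _ = √S * M := by rw [Real.sqrt_mul (by positivity), Real.sqrt_sq hM]

theorem sqrt_mul_level_le {h : Fin m → ℝ} {G : Finset (Fin m)} {S : ℕ} (hS : 0 < S)
    (hG : G.card = S) {M : ℝ} (hM : ∀ i ∈ G, M ≤ |h i|) : √S * M ≤ (∑ i ∈ G, |h i|) / √S := by
  have hS' : (0 : ℝ) < S := by exact_mod_cast hS
  rw [le_div_iff₀ (Real.sqrt_pos.2 hS')]
  calc √S * M * √S = ∑ _i ∈ G, M := by
        rw [Finset.sum_const, hG, nsmul_eq_mul]
        linear_combination M * Real.mul_self_sqrt hS'.le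
    _ ≤ _ := Finset.sum_le_sum hM

/-- Cutting `E` into blocks of `S` entries in decreasing order of magnitude: each block after the
first has Euclidean norm at most the `ℓ¹` norm of its predecessor divided by `√S`, so that the
correlations of the blocks with `A c` add up to at most `√S M + ‖h_E‖₁ / √S`. -/
theorem abs_correlation_trunc_le (A : Matrix (Fin n) (Fin m) ℝ) {S : ℕ} (hS : 0 < S)
    (h c : Fin m → ℝ) {R : ℕ} (hc : (supp c).card ≤ R) (k : ℕ) (E : Finset (Fin m))
    (hk : E.card ≤ k)
    (hd : Disjoint (supp c) E) {M : ℝ} (hM : 0 ≤ M) (hb : ∀ i ∈ E, |h i| ≤ M) :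
    |(A *ᵥ trunc E h) ⬝ᵥ (A *ᵥ c)|
      ≤ rocTheta A S R * √(sqNorm c) * (√S * M + (∑ i ∈ E, |h i|) / √S) := by
  have block : ∀ (G : Finset (Fin m)) (M : ℝ), G ⊆ E → G.card ≤ S → 0 ≤ M → (∀ i ∈ G, |h i| ≤ M) →
      |(A *ᵥ trunc G h) ⬝ᵥ (A *ᵥ c)| ≤ rocTheta A S R * √(sqNorm c) * (√S * M) := by
    intro G M hGE hG hM hb
    calc _ ≤ rocTheta A S R * (√(sqNorm (trunc G h)) * √(sqNorm c)) :=
          rocTheta_bound A ((card_supp_trunc_le G h).trans hG) hc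
            (hd.mono_right ((supp_trunc_subset G h).trans hGE)).symm
      _ ≤ rocTheta A S R * ((√S * M) * √(sqNorm c)) := by
          have := rocTheta_nonneg A S R
          gcongr
          exact sqrt_sqNorm_trunc_le hG hM hb
      _ = _ := by ring
  have hθ : 0 ≤ rocTheta A S R * √(sqNorm c) :=
    mul_nonneg (rocTheta_nonneg A S R) (Real.sqrt_nonneg _)
  have hsum : ∀ G : Finset (Fin m), 0 ≤ ∑ i ∈ G, |h i| :=
    fun G => Finset.sum_nonneg fun _ _ => abs_nonneg _
  induction k generalizing E M with
  | zero =>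
    refine (block E M subset_rfl (by omega) hM hb).trans (mul_le_mul_of_nonneg_left ?_ hθ)
    have := div_nonneg (hsum E) (Real.sqrt_nonneg S)
    linarith
  | succ k ih =>
    by_cases hES : E.card ≤ S
    · refine (block E M subset_rfl hES hM hb).trans (mul_le_mul_of_nonneg_left ?_ hθ)
      have := div_nonneg (hsum E) (Real.sqrt_nonneg S)
      linarith
    · obtain ⟨G, hGE, hG, M', hM', hM1, hM2⟩ := exists_largest_entries h E (S := S) (by omega)
      have h1 := block G M hGE hG.le hM fun i hi => hb i (hGE hi)
      have h2 := ih (E \ G) (by rw [Finset.card_sdiff_of_subset hGE]; omega)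
        (hd.mono_right Finset.sdiff_subset) hM' hM2
        (fun G' M hG' => block G' M (hG'.trans Finset.sdiff_subset))
      have h3 := sqrt_mul_level_le hS hG hM1
      rw [← trunc_add_trunc_sdiff hGE, Matrix.mulVec_add, add_dotProduct]
      refine (abs_add_le _ _).trans ((add_le_add h1 h2).trans ?_)
      rw [← mul_add]
      refine mul_le_mul_of_nonneg_left ?_ hθ
      rw [← Finset.sum_sdiff hGE, add_div]
      linarith

/-- The error of two vectors that both explain the data: if `A'Ah` is uniformly small, then `h`
is controlled by its `ℓ¹` norm off a set `F` of `S` indices. Here `u` is the Euclidean norm of `h`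
on `F` together with the `S` largest entries off `F`. -/
theorem exists_core_bound (A : Matrix (Fin n) (Fin m) ℝ) {S : ℕ} (hS : 0 < S)
    (h : Fin m → ℝ) (F : Finset (Fin m)) (hF : F.card ≤ S) {κ : ℝ} (hκ0 : 0 ≤ κ)
    (hκ : ∀ j, |(Aᵀ *ᵥ (A *ᵥ h)) j| ≤ κ) :
    ∃ u, 0 ≤ u ∧ ∑ i ∈ F, |h i| ≤ √S * u ∧
      (1 - ricDelta A (2 * S)) * u
        ≤ √2 * √S * κ + rocTheta A S (2 * S) * ((∑ i ∈ Fᶜ, |h i|) / √S) ∧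
      sqNorm h ≤ u ^ 2 + ((∑ i ∈ Fᶜ, |h i|) / √S) ^ 2 := by
  classical
  set E := Fᶜ with hE
  have hS' : (0 : ℝ) < S := by exact_mod_cast hS
  have hsS : 0 < √(S : ℝ) := Real.sqrt_pos.2 hS'
  -- `G` is the first block off `F`, and `M` bounds the entries that follow it
  obtain ⟨G, hGE, hG, M, hM, hGM, hM2, hM3⟩ : ∃ G ⊆ E, G.card ≤ S ∧ ∃ M, 0 ≤ M ∧
      (√S * M ≤ (∑ i ∈ G, |h i|) / √S) ∧ (∀ i ∈ E \ G, |h i| ≤ M) ∧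
      S * M ≤ ∑ i ∈ E, |h i| := by
    by_cases hES : E.card ≤ S
    · refine ⟨E, subset_rfl, hES, 0, le_rfl, ?_, by simp, ?_⟩
      · rw [mul_zero]
        exact div_nonneg (Finset.sum_nonneg fun _ _ => abs_nonneg _) hsS.le
      · rw [mul_zero]
        exact Finset.sum_nonneg fun _ _ => abs_nonneg _
    · obtain ⟨G, hGE, hG, M, hM, hM1, hM2⟩ := exists_largest_entries h E (S := S) (by omega)
      refine ⟨G, hGE, hG.le, M, hM, sqrt_mul_level_le hS hG hM1, hM2, ?_⟩
      calc (S : ℝ) * M = ∑ _i ∈ G, M := by rw [Finset.sum_const, hG, nsmul_eq_mul]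
        _ ≤ ∑ i ∈ G, |h i| := Finset.sum_le_sum hM1
        _ ≤ _ := Finset.sum_le_sum_of_subset_of_nonneg hGE fun _ _ _ => abs_nonneg _
  have hFG : Disjoint F G := by
    rw [Finset.disjoint_left]
    intro i hi hi'
    simpa [hE, hi] using hGE hi'
  have hcompl : Finset.univ \ (F ∪ G) = E \ G := by
    ext i; simp [hE]
  have hcard : (F ∪ G).card ≤ 2 * S := by
    have := Finset.card_union_le F G
    omega
  set c := trunc (F ∪ G) h with hc
  have hcs : (supp c).card ≤ 2 * S := (card_supp_trunc_le _ _).trans hcard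
  have hsplit : h = c + trunc (E \ G) h := by
    rw [← hcompl, hc, trunc_add_trunc_sdiff (Finset.subset_univ _)]
    exact (trunc_eq_self (by simp)).symm
  set u := √(sqNorm c) with hu
  have hu0 : 0 ≤ u := Real.sqrt_nonneg _
  have hu2 : u ^ 2 = sqNorm c := Real.sq_sqrt (sqNorm_nonneg c)
  refine ⟨u, hu0, ?_, ?_, ?_⟩
  · refine le_of_abs_le (abs_le_of_sq_le_sq ?_ (by positivity))
    refine (sum_abs_sq_le F h).trans ?_
    rw [mul_pow, Real.sq_sqrt hS'.le, hu2, hc, sqNorm_trunc]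
    refine mul_le_mul (by exact_mod_cast hF) ?_ (Finset.sum_nonneg fun _ _ => sq_nonneg _) hS'.le
    exact Finset.sum_le_sum_of_subset_of_nonneg Finset.subset_union_left fun _ _ _ => sq_nonneg _
  · rcases hu0.eq_or_lt with hu00 | hupos
    · rw [← hu00, mul_zero]
      have h1 := rocTheta_nonneg A S (2 * S)
      have : 0 ≤ ∑ i ∈ E, |h i| := Finset.sum_nonneg fun _ _ => abs_nonneg _
      positivity
    · have key : sqNorm (A *ᵥ c) = c ⬝ᵥ (Aᵀ *ᵥ (A *ᵥ h))
          - (A *ᵥ trunc (E \ G) h) ⬝ᵥ (A *ᵥ c) := by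
        rw [← mulVec_dotProduct_eq, ← dotProduct_self_eq_sqNorm]
        have hA : A *ᵥ h = A *ᵥ c + A *ᵥ trunc (E \ G) h := by
          rw [← Matrix.mulVec_add, ← hsplit]
        rw [hA, dotProduct_add, dotProduct_comm (A *ᵥ trunc (E \ G) h)]
        ring
      have hd : Disjoint (supp c) (E \ G) := by
        refine Finset.disjoint_of_subset_left (supp_trunc_subset _ _) ?_
        rw [← hcompl]
        exact Finset.disjoint_sdiff
      have h1 : |(A *ᵥ trunc (E \ G) h) ⬝ᵥ (A *ᵥ c)|
          ≤ rocTheta A S (2 * S) * u * ((∑ i ∈ E, |h i|) / √S) := by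
        refine (abs_correlation_trunc_le A hS h c hcs _ _ le_rfl hd hM hM2).trans ?_
        refine mul_le_mul_of_nonneg_left ?_ (mul_nonneg (rocTheta_nonneg _ _ _) hu0)
        rw [← Finset.sum_sdiff hGE, add_div]
        linarith
      have h2 : |c ⬝ᵥ (Aᵀ *ᵥ (A *ᵥ h))| ≤ √2 * √S * κ * u := by
        have hl1 : l1Norm c ≤ √2 * √S * u := by
          refine le_of_abs_le (abs_le_of_sq_le_sq ?_ (by positivity))
          rw [hc, l1Norm_trunc]
          refine (sum_abs_sq_le _ h).trans ?_
          rw [mul_pow, mul_pow, Real.sq_sqrt hS'.le, Real.sq_sqrt zero_le_two, hu2, hc,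
            sqNorm_trunc]
          refine mul_le_mul_of_nonneg_right ?_ (Finset.sum_nonneg fun _ _ => sq_nonneg _)
          exact_mod_cast hcard
        calc |c ⬝ᵥ (Aᵀ *ᵥ (A *ᵥ h))| ≤ ∑ i, |c i| * κ := by
              refine (Finset.abs_sum_le_sum_abs _ _).trans (Finset.sum_le_sum fun i _ => ?_)
              rw [abs_mul]
              exact mul_le_mul_of_nonneg_left (hκ i) (abs_nonneg _)
          _ = l1Norm c * κ := by rw [← Finset.sum_mul]; rfl
          _ ≤ √2 * √S * u * κ := by gcongr
          _ = _ := by ring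
      have h3 := ricDelta_lower A hcs
      rw [key, ← hu2] at h3
      refine le_of_mul_le_mul_right ?_ hupos
      have h4 := (abs_le.1 h1).1
      have h5 := (abs_le.1 h2).2
      linarith
  · have h1 : sqNorm h = u ^ 2 + ∑ i ∈ E \ G, h i ^ 2 := by
      rw [hu2, hc, sqNorm_trunc, ← hcompl, add_comm, Finset.sum_sdiff (Finset.subset_univ _)]
      rfl
    rw [h1]
    refine add_le_add_right ?_ _
    have h2 : 0 ≤ ∑ i ∈ E, |h i| := Finset.sum_nonneg fun _ _ => abs_nonneg _
    rw [div_pow, Real.sq_sqrt hS'.le, le_div_iff₀ hS']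
    calc (∑ i ∈ E \ G, h i ^ 2) * S ≤ (M * ∑ i ∈ E \ G, |h i|) * S := by
          rw [Finset.mul_sum]
          gcongr with i hi
          rw [← sq_abs, sq]
          exact mul_le_mul_of_nonneg_right (hM2 i hi) (abs_nonneg _)
      _ ≤ (M * ∑ i ∈ E, |h i|) * S := by
          gcongr
          exact Finset.sdiff_subset
      _ = (S * M) * ∑ i ∈ E, |h i| := by ring
      _ ≤ (∑ i ∈ E, |h i|) ^ 2 := by rw [sq]; gcongr

/-- The Dantzig selector error for a vector `b` that is feasible, in terms of the part of `b` off
an arbitrary set `F` of at most `S` indices. -/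
theorem sqNorm_sub_dantzig_le (A : Matrix (Fin n) (Fin m) ℝ) {S : ℕ} (hS : 0 < S)
    (hinc : ricDelta A (2 * S) + rocTheta A S (2 * S) < 1) {s : ℝ} (hs : 0 ≤ s) {r : Fin n → ℝ}
    {b bhat : Fin m → ℝ} (hb : DantzigFeasible A (lam m * s) r b)
    (hhat : IsDantzigSelector A (lam m * s) r bhat) (F : Finset (Fin m)) (hF : F.card ≤ S) :
    sqNorm (b - bhat) ≤ C2 A S * S * s ^ 2 + C3 A S * ((∑ i ∈ Fᶜ, |b i|) ^ 2 / S) := by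
  have hS' : (0 : ℝ) < S := by exact_mod_cast hS
  have hsS : 0 < √(S : ℝ) := Real.sqrt_pos.2 hS'
  set h := b - bhat with hh
  set κ := lam m * s with hκ
  have hAh : ∀ j, |(Aᵀ *ᵥ (A *ᵥ h)) j| ≤ 2 * κ := by
    intro j
    have : (Aᵀ *ᵥ (A *ᵥ h)) j = (Aᵀ *ᵥ (r - A *ᵥ bhat)) j - (Aᵀ *ᵥ (r - A *ᵥ b)) j := by
      rw [← Pi.sub_apply, ← Matrix.mulVec_sub, hh, Matrix.mulVec_sub,
        sub_sub_sub_cancel_left]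
    rw [this]
    have h1 := abs_le.1 (hhat.1 j)
    have h2 := abs_le.1 (hb j)
    rw [abs_le]
    constructor <;> linarith [h1.1, h1.2, h2.1, h2.2]
  have hκ0 : 0 ≤ κ := mul_nonneg (Real.sqrt_nonneg _) hs
  obtain ⟨u, hu0, hu1, hu2, hu3⟩ := exists_core_bound A hS h F hF
    (mul_nonneg zero_le_two hκ0) hAh
  set e := ∑ i ∈ Fᶜ, |b i| with he
  have he0 : 0 ≤ e := Finset.sum_nonneg fun _ _ => abs_nonneg _
  -- the cone condition, from the minimality of `bhat`
  have hcone : ∑ i ∈ Fᶜ, |h i| ≤ √S * u + 2 * e := by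
    have hmin : ∑ i ∈ F, |bhat i| + ∑ i ∈ Fᶜ, |bhat i| ≤ ∑ i ∈ F, |b i| + ∑ i ∈ Fᶜ, |b i| := by
      rw [Finset.sum_add_sum_compl, Finset.sum_add_sum_compl]
      exact hhat.2 b hb
    have h1 : ∑ i ∈ F, |b i| ≤ ∑ i ∈ F, |bhat i| + ∑ i ∈ F, |h i| := by
      rw [← Finset.sum_add_distrib]
      refine Finset.sum_le_sum fun i _ => ?_
      have := abs_add_le (bhat i) (h i)
      simpa [hh] using this
    have h2 : ∑ i ∈ Fᶜ, |h i| ≤ ∑ i ∈ Fᶜ, |bhat i| + ∑ i ∈ Fᶜ, |b i| := by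
      rw [← Finset.sum_add_distrib]
      refine Finset.sum_le_sum fun i _ => ?_
      have := abs_sub (b i) (bhat i)
      simp only [hh, Pi.sub_apply]
      linarith
    linarith
  set θ := rocTheta A S (2 * S)
  set δ := ricDelta A (2 * S)
  have hθ : 0 ≤ θ := rocTheta_nonneg _ _ _
  set p := e / √S with hp
  have hp0 : 0 ≤ p := by positivity
  have hcone' : (∑ i ∈ Fᶜ, |h i|) / √S ≤ u + 2 * p := by
    rw [div_le_iff₀ hsS, hp]
    have : (u + 2 * (e / √S)) * √S = √S * u + 2 * e := by field_simp
    rw [this]; exact hcone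
  have hD : 0 < 1 - δ - θ := by linarith
  have hu4 : (1 - δ - θ) * u ≤ 2 * (√2 * √S * κ) + 2 * (θ * p) := by
    have := mul_le_mul_of_nonneg_left hcone' hθ
    linarith
  have hu5 : (1 - δ - θ) ^ 2 * u ^ 2 ≤ 16 * (S * κ ^ 2) + 8 * (θ ^ 2 * p ^ 2) := by
    have h1 := pow_le_pow_left₀ (by positivity) hu4 2
    have h2 : (√2 * √S * κ) ^ 2 = 2 * (S * κ ^ 2) := by
      rw [mul_pow, mul_pow, Real.sq_sqrt hS'.le, Real.sq_sqrt zero_le_two]; ring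
    nlinarith [sq_nonneg (√2 * √S * κ - θ * p)]
  have hu6 : u ^ 2 ≤ (16 * (S * κ ^ 2) + 8 * (θ ^ 2 * p ^ 2)) / (1 - δ - θ) ^ 2 := by
    rw [le_div_iff₀ (by positivity)]; linarith
  have htail : ((∑ i ∈ Fᶜ, |h i|) / √S) ^ 2 ≤ 2 * u ^ 2 + 8 * p ^ 2 := by
    have h1 := pow_le_pow_left₀ (div_nonneg (Finset.sum_nonneg fun _ _ => abs_nonneg _) hsS.le)
      hcone' 2
    nlinarith [sq_nonneg (u - 2 * p)]
  have hp2 : p ^ 2 = e ^ 2 / S := by rw [hp, div_pow, Real.sq_sqrt hS'.le]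
  calc sqNorm h ≤ 3 * u ^ 2 + 8 * p ^ 2 := by linarith
    _ ≤ 3 * ((16 * (S * κ ^ 2) + 8 * (θ ^ 2 * p ^ 2)) / (1 - δ - θ) ^ 2) + 8 * p ^ 2 := by linarith
    _ = C2 A S * S * s ^ 2 + C3 A S * p ^ 2 := by
        rw [C2, C3, hκ]; ring
    _ = _ := by rw [hp2]

/-! ### Least squares on a support estimate -/

/-- The matrix of the linear map `y ↦ lsEst A U y`. -/
def lsMat (A : Matrix (Fin n) (Fin m) ℝ) (U : Finset (Fin m)) : Matrix (Fin m) (Fin n) ℝ :=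
  Matrix.of fun i k =>
    if h : i ∈ U then (((colSub A U)ᵀ * colSub A U)⁻¹ * (colSub A U)ᵀ) ⟨i, h⟩ k else 0

theorem lsEst_eq_mulVec (A : Matrix (Fin n) (Fin m) ℝ) (U : Finset (Fin m)) (y : Fin n → ℝ) :
    lsEst A U y = lsMat A U *ᵥ y := by
  ext i
  by_cases h : i ∈ U
  · simp [lsEst, lsMat, Matrix.mulVec, h, dotProduct, Matrix.mul_apply, Finset.sum_mul,
      Finset.mul_sum]
    rw [Finset.sum_comm]
    exact Finset.sum_congr rfl fun _ _ => Finset.sum_congr rfl fun _ _ => by ring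
  · simp [lsEst, lsMat, Matrix.mulVec, h, dotProduct]

theorem lsEst_eq_zero_of_notMem (A : Matrix (Fin n) (Fin m) ℝ) {U : Finset (Fin m)} {i : Fin m}
    (h : i ∉ U) (y : Fin n → ℝ) : lsEst A U y i = 0 := dif_neg h

theorem card_supp_le {U : Finset (Fin m)} {c : Fin m → ℝ} (hc : ∀ i ∉ U, c i = 0) :
    (supp c).card ≤ U.card := by
  rw [← trunc_eq_self hc]
  exact card_supp_trunc_le U c

theorem mulVec_eq_colSub (A : Matrix (Fin n) (Fin m) ℝ) {U : Finset (Fin m)} {c : Fin m → ℝ}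
    (hc : ∀ i ∉ U, c i = 0) : A *ᵥ c = colSub A U *ᵥ fun i => c i := by
  ext k
  simp only [Matrix.mulVec, dotProduct, colSub, Matrix.submatrix_apply, id]
  rw [Finset.sum_coe_sort U fun i => A k i * c i]
  exact (Finset.sum_subset (Finset.subset_univ U) fun i _ hi => by simp [hc i hi]).symm

theorem eq_zero_of_sqNorm_le {ι : Type*} [Fintype ι] {v : ι → ℝ} (h : sqNorm v ≤ 0) : v = 0 := by
  ext i
  have h1 := Finset.single_le_sum (f := fun i => v i ^ 2) (fun _ _ => sq_nonneg _)
    (Finset.mem_univ i)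
  have h2 : v i ^ 2 ≤ 0 := h1.trans h
  exact pow_eq_zero_iff two_ne_zero |>.1 (le_antisymm h2 (sq_nonneg _))

theorem eq_zero_of_mulVec_eq_zero (A : Matrix (Fin n) (Fin m) ℝ) {U : Finset (Fin m)}
    (hU : ricDelta A U.card < 1) {c : Fin m → ℝ} (hc : ∀ i ∉ U, c i = 0)
    (h : sqNorm (A *ᵥ c) ≤ 0) : c = 0 := by
  have h1 := ricDelta_lower A (card_supp_le hc)
  refine eq_zero_of_sqNorm_le ?_
  by_contra hpos
  push Not at hpos
  nlinarith [mul_pos (sub_pos.2 hU) hpos]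

theorem isUnit_gram (A : Matrix (Fin n) (Fin m) ℝ) {U : Finset (Fin m)}
    (hU : ricDelta A U.card < 1) : IsUnit ((colSub A U)ᵀ * colSub A U) := by
  rw [← Matrix.mulVec_injective_iff_isUnit]
  intro v v' hv
  rw [← sub_eq_zero]
  set d := v - v' with hd
  have hGd : ((colSub A U)ᵀ * colSub A U) *ᵥ d = 0 := by
    rw [hd, Matrix.mulVec_sub]; exact sub_eq_zero.2 hv
  set c : Fin m → ℝ := fun i => if h : i ∈ U then d ⟨i, h⟩ else 0 with hc
  have hc0 : ∀ i ∉ U, c i = 0 := fun i hi => dif_neg hi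
  have hcd : (fun i : U => c i) = d := by ext i; simp [hc]
  have hcz : c = 0 := by
    refine eq_zero_of_mulVec_eq_zero A hU hc0 ?_
    rw [mulVec_eq_colSub A hc0, hcd, ← dotProduct_self_eq_sqNorm, Matrix.dotProduct_mulVec,
      ← Matrix.mulVec_transpose, Matrix.mulVec_mulVec, hGd, zero_dotProduct]
  rw [← hcd, hcz]; rfl

/-- The normal equations: the residual is orthogonal to the columns of `A` in `U`. -/
theorem normal_equations (A : Matrix (Fin n) (Fin m) ℝ) {U : Finset (Fin m)}
    (hU : ricDelta A U.card < 1) {c : Fin m → ℝ} (hc : ∀ i ∉ U, c i = 0) (y : Fin n → ℝ) :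
    (A *ᵥ c) ⬝ᵥ (A *ᵥ lsEst A U y) = (A *ᵥ c) ⬝ᵥ y := by
  rw [mulVec_eq_colSub A hc,
    mulVec_eq_colSub A (c := lsEst A U y) fun i hi => lsEst_eq_zero_of_notMem A hi y]
  have h1 : (fun i : U => lsEst A U y i)
      = ((colSub A U)ᵀ * colSub A U)⁻¹ *ᵥ ((colSub A U)ᵀ *ᵥ y) := by
    ext i; simp [lsEst]
  have hdet := (Matrix.isUnit_iff_isUnit_det _).1 (isUnit_gram A hU)
  have key : (colSub A U)ᵀ *ᵥ (colSub A U *ᵥ fun i : U => lsEst A U y i) = (colSub A U)ᵀ *ᵥ y := by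
    rw [h1, Matrix.mulVec_mulVec, Matrix.mulVec_mulVec, Matrix.mul_nonsing_inv _ hdet,
      Matrix.one_mulVec]
  have move : ∀ (u : U → ℝ) (z : Fin n → ℝ),
      (colSub A U *ᵥ u) ⬝ᵥ z = u ⬝ᵥ ((colSub A U)ᵀ *ᵥ z) := fun u z => by
    rw [Matrix.mulVec_transpose, dotProduct_comm, Matrix.dotProduct_mulVec, dotProduct_comm]
  rw [move, move, key]

theorem lsEst_mulVec_self (A : Matrix (Fin n) (Fin m) ℝ) {U : Finset (Fin m)}
    (hU : ricDelta A U.card < 1) {c : Fin m → ℝ} (hc : ∀ i ∉ U, c i = 0) :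
    lsEst A U (A *ᵥ c) = c := by
  rw [← sub_eq_zero]
  set d := lsEst A U (A *ᵥ c) - c with hd
  have hd0 : ∀ i ∉ U, d i = 0 := fun i hi => by
    simp [hd, hc i hi, lsEst_eq_zero_of_notMem A hi]
  refine eq_zero_of_mulVec_eq_zero A hU hd0 (le_of_eq ?_)
  rw [← dotProduct_self_eq_sqNorm]
  have h1 := normal_equations A hU hd0 (A *ᵥ c)
  have h2 : A *ᵥ d = A *ᵥ lsEst A U (A *ᵥ c) - A *ᵥ c := by rw [hd, Matrix.mulVec_sub]
  calc (A *ᵥ d) ⬝ᵥ (A *ᵥ d) = (A *ᵥ d) ⬝ᵥ (A *ᵥ lsEst A U (A *ᵥ c) - A *ᵥ c) :=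
        congrArg (fun z => (A *ᵥ d) ⬝ᵥ z) h2
    _ = 0 := by rw [dotProduct_sub, h1, sub_self]

theorem sqNorm_lsEst_le (A : Matrix (Fin n) (Fin m) ℝ) {U : Finset (Fin m)}
    (hU : ricDelta A U.card < 1) (y : Fin n → ℝ) :
    (1 - ricDelta A U.card) * sqNorm (lsEst A U y) ≤ sqNorm y := by
  set v := lsEst A U y
  have hv : ∀ i ∉ U, v i = 0 := fun i hi => lsEst_eq_zero_of_notMem A hi y
  refine (ricDelta_lower A (card_supp_le hv)).trans ?_
  have h1 := normal_equations A hU hv y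
  rw [dotProduct_self_eq_sqNorm] at h1
  have h2 := sq_dotProduct_le (A *ᵥ v) y
  rw [← h1] at h2
  rcases (sqNorm_nonneg (A *ᵥ v)).eq_or_lt with h0 | h0
  · rw [← h0]; exact sqNorm_nonneg y
  · rw [sq] at h2
    exact le_of_mul_le_mul_left h2 h0

theorem sqNorm_lsEst_mulVec_le (A : Matrix (Fin n) (Fin m) ℝ) {U D : Finset (Fin m)}
    (hU : ricDelta A U.card < 1) (hUD : Disjoint U D) {c : Fin m → ℝ} (hc : ∀ i ∉ D, c i = 0) :
    sqNorm (lsEst A U (A *ᵥ c))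
      ≤ rocTheta A U.card D.card ^ 2 / (1 - ricDelta A U.card) ^ 2 * sqNorm c := by
  set v := lsEst A U (A *ᵥ c)
  have hv : ∀ i ∉ U, v i = 0 := fun i hi => lsEst_eq_zero_of_notMem A hi _
  have h1 := ricDelta_lower A (card_supp_le hv)
  have h2 := normal_equations A hU hv (A *ᵥ c)
  rw [dotProduct_self_eq_sqNorm] at h2
  have hsub : Disjoint (supp v) (supp c) := by
    rw [← trunc_eq_self hv, ← trunc_eq_self hc]
    exact hUD.mono (supp_trunc_subset U v) (supp_trunc_subset D c)
  have h3 := (le_abs_self _).trans (rocTheta_bound A (card_supp_le hv) (card_supp_le hc) hsub)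
  have hδ : 0 < 1 - ricDelta A U.card := sub_pos.2 hU
  have hp := Real.sq_sqrt (sqNorm_nonneg v)
  have hq := Real.sq_sqrt (sqNorm_nonneg c)
  set p := √(sqNorm v)
  set q := √(sqNorm c)
  have hp0 : 0 ≤ p := Real.sqrt_nonneg _
  have hq0 : 0 ≤ q := Real.sqrt_nonneg _
  have hθ := rocTheta_nonneg A U.card D.card
  rw [← hp, ← hq, div_mul_eq_mul_div, le_div_iff₀ (by positivity)]
  have h4 : (1 - ricDelta A U.card) * p ≤ rocTheta A U.card D.card * q := by
    rcases hp0.eq_or_lt with h0 | h0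
    · rw [← h0, mul_zero]; positivity
    · refine le_of_mul_le_mul_right ?_ h0
      rw [← hp] at h1
      linarith
  have h5 := pow_le_pow_left₀ (by positivity) h4 2
  linarith

theorem sq_apply_le_sqNorm {ι : Type*} [Fintype ι] (v : ι → ℝ) (i : ι) : v i ^ 2 ≤ sqNorm v :=
  Finset.single_le_sum (f := fun i => v i ^ 2) (fun _ _ => sq_nonneg _) (Finset.mem_univ i)

theorem le_of_sq_le_mul {a b : ℝ} (ha : 0 ≤ a) (hb : 0 ≤ b) (h : a ^ 2 ≤ b * a) : a ≤ b := by
  rcases ha.eq_or_lt with h0 | h0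
  · rwa [← h0]
  · rw [sq] at h
    exact le_of_mul_le_mul_right h h0

/-- The noise gain of one coordinate of the least squares estimate, from applying the estimate
to the row itself. -/
theorem sqNorm_lsMat_row_le (A : Matrix (Fin n) (Fin m) ℝ) {U : Finset (Fin m)}
    (hU : ricDelta A U.card < 1) (i : Fin m) :
    sqNorm (lsMat A U i) ≤ 1 / (1 - ricDelta A U.card) := by
  have hδ : 0 < 1 - ricDelta A U.card := sub_pos.2 hU
  refine le_of_sq_le_mul (sqNorm_nonneg _) (by positivity) ?_
  have h1 : sqNorm (lsMat A U i) = lsEst A U (lsMat A U i) i := by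
    rw [lsEst_eq_mulVec, ← dotProduct_self_eq_sqNorm]; rfl
  have h2 := sqNorm_lsEst_le A hU (lsMat A U i)
  rw [one_div, inv_mul_eq_div, le_div_iff₀ hδ]
  calc _ ≤ sqNorm (lsEst A U (lsMat A U i)) * (1 - ricDelta A U.card) := by
        gcongr
        nth_rewrite 1 [h1]
        exact sq_apply_le_sqNorm _ i
    _ ≤ _ := by linarith

/-- The row of `(A_U' A_U)⁻¹ A_U' A_D` with index `i`, as a vector of `ℝ^m` (zero off `D`, and
zero altogether for `i ∉ U`). It is the leakage of `x_D` into the estimate of `x_i`. -/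
def leakRow (A : Matrix (Fin n) (Fin m) ℝ) (U D : Finset (Fin m)) (i : Fin m) : Fin m → ℝ :=
  trunc D ((lsMat A U * A) i)

theorem leakRow_eq_zero (A : Matrix (Fin n) (Fin m) ℝ) (U D : Finset (Fin m)) (i : Fin m) :
    ∀ j ∉ D, leakRow A U D i j = 0 := fun _ hj => if_neg hj

theorem leakRow_dotProduct (A : Matrix (Fin n) (Fin m) ℝ) (U D : Finset (Fin m)) (i : Fin m)
    (x : Fin m → ℝ) : leakRow A U D i ⬝ᵥ x = lsEst A U (A *ᵥ trunc D x) i := by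
  rw [lsEst_eq_mulVec, Matrix.mulVec_mulVec]
  simp only [leakRow, Matrix.mulVec, dotProduct, trunc]
  exact Finset.sum_congr rfl fun j _ => by split_ifs <;> simp

theorem sqNorm_leakRow_le (A : Matrix (Fin n) (Fin m) ℝ) {U D : Finset (Fin m)}
    (hU : ricDelta A U.card < 1) (hUD : Disjoint U D) (i : Fin m) :
    sqNorm (leakRow A U D i)
      ≤ rocTheta A U.card D.card ^ 2 / (1 - ricDelta A U.card) ^ 2 := by
  refine le_of_sq_le_mul (sqNorm_nonneg _) (by positivity) ?_
  have h1 : sqNorm (leakRow A U D i) = lsEst A U (A *ᵥ leakRow A U D i) i := by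
    rw [← dotProduct_self_eq_sqNorm, leakRow_dotProduct, trunc_eq_self (leakRow_eq_zero A U D i)]
  refine le_trans ?_ (sqNorm_lsEst_mulVec_le A hU hUD (leakRow_eq_zero A U D i))
  nth_rewrite 1 [h1]
  exact sq_apply_le_sqNorm _ i

theorem sum_sq_leakRow_le (A : Matrix (Fin n) (Fin m) ℝ) {U D : Finset (Fin m)}
    (hU : ricDelta A U.card < 1) (hUD : Disjoint U D) (E : Finset (Fin m)) (x : Fin m → ℝ) :
    ∑ i ∈ E, (leakRow A U D i ⬝ᵥ x) ^ 2
      ≤ rocTheta A U.card D.card ^ 2 / (1 - ricDelta A U.card) ^ 2 * ∑ i ∈ D, x i ^ 2 := by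
  rw [← sqNorm_trunc D x]
  refine le_trans ?_ (sqNorm_lsEst_mulVec_le A hU hUD (c := trunc D x) fun i hi => if_neg hi)
  simp only [leakRow_dotProduct]
  exact Finset.sum_le_sum_of_subset_of_nonneg (Finset.subset_univ E) fun _ _ _ => sq_nonneg _

/-- On the support estimate the residual consists of the leakage of the undetected part of the
signal and of the filtered noise. -/
theorem residual_apply_of_mem (A : Matrix (Fin n) (Fin m) ℝ) {U D : Finset (Fin m)}
    (hU : ricDelta A U.card < 1) (hUD : Disjoint U D) {x : Fin m → ℝ}
    (hx : ∀ i ∉ U ∪ D, x i = 0) (w : Fin n → ℝ) {i : Fin m} (hi : i ∈ U) :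
    x i - lsEst A U (A *ᵥ x + w) i = -(leakRow A U D i ⬝ᵥ x + lsMat A U i ⬝ᵥ w) := by
  have hsplit : x = trunc U x + trunc D x := by
    ext j
    simp only [trunc, Pi.add_apply]
    by_cases h1 : j ∈ U
    · simp [h1, Finset.disjoint_left.1 hUD h1]
    · by_cases h2 : j ∈ D
      · simp [h1, h2]
      · simp [h1, h2, hx j (by simp [h1, h2])]
  have h1 : lsEst A U (A *ᵥ x + w) i
      = lsEst A U (A *ᵥ trunc U x) i + lsEst A U (A *ᵥ trunc D x) i + lsEst A U w i := by
    nth_rewrite 1 [hsplit]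
    simp only [lsEst_eq_mulVec, Matrix.mulVec_add, Pi.add_apply]
  rw [h1, lsEst_mulVec_self A hU (c := trunc U x) fun j hj => if_neg hj, leakRow_dotProduct,
    lsEst_eq_mulVec A U w]
  have h2 : trunc U x i = x i := if_pos hi
  have h3 : (lsMat A U *ᵥ w) i = lsMat A U i ⬝ᵥ w := rfl
  rw [h2, h3]; ring

/-! ### The largest eigenvalue -/

theorem dotProduct_mulVec_le_lambdaMax {ι : Type*} [Fintype ι] [DecidableEq ι] {M : Matrix ι ι ℝ}
    (hM : M.IsHermitian) (v : ι → ℝ) : v ⬝ᵥ (M *ᵥ v) ≤ lambdaMax M * sqNorm v := by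
  have hps : (algebraMap ℝ (Matrix ι ι ℝ) (lambdaMax M) - M).PosSemidef := by
    rw [Matrix.posSemidef_iff_isHermitian_and_spectrum_nonneg]
    refine ⟨Matrix.IsHermitian.sub
      (by simp [Matrix.IsHermitian, Matrix.algebraMap_eq_diagonal]) hM, ?_⟩
    rw [← spectrum.singleton_sub_eq]
    rintro a ⟨b, hb, c, hc, rfl⟩
    rw [Set.mem_singleton_iff.1 hb]
    exact sub_nonneg.2 (le_csSup M.finite_real_spectrum.bddAbove hc)
  have h := hps.dotProduct_mulVec_nonneg v
  rw [star_trivial, Matrix.sub_mulVec, dotProduct_sub, Algebra.algebraMap_eq_smul_one,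
    Matrix.smul_mulVec, Matrix.one_mulVec, dotProduct_smul, dotProduct_self_eq_sqNorm] at h
  simpa using h

theorem lambdaMax_nonneg {ι : Type*} [Fintype ι] [DecidableEq ι] {M : Matrix ι ι ℝ}
    (hM : M.IsHermitian) (hd : ∀ i, 0 ≤ M i i) : 0 ≤ lambdaMax M := by
  rcases isEmpty_or_nonempty ι with he | ⟨⟨i⟩⟩
  · have : spectrum ℝ M = ∅ := spectrum.of_subsingleton M
    rw [lambdaMax, this, Real.sSup_empty]
  · have h := dotProduct_mulVec_le_lambdaMax hM (Pi.single i 1)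
    have h1 : sqNorm (Pi.single i (1 : ℝ)) = 1 := by
      rw [← dotProduct_self_eq_sqNorm]; simp
    rw [h1, mul_one] at h
    refine (hd i).trans (le_trans (le_of_eq ?_) h)
    simp

/-! ### Conditional expectations of squares -/

section Conditioning

variable {Ω : Type*} {F H : MeasurableSpace Ω} [m0 : MeasurableSpace Ω] {μ : Measure Ω}

/-- Conditional expectations are monotone locally, on an event of the conditioning `σ`-algebra. -/
theorem condExp_le_condExp_on {f g : Ω → ℝ} {s : Set Ω}
    (hf : Integrable f μ) (hg : Integrable g μ) (hF : F ≤ m0) (hs : MeasurableSet[F] s)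
    (h : ∀ᵐ ω ∂μ, ω ∈ s → f ω ≤ g ω) : ∀ᵐ ω ∂μ, ω ∈ s → (μ[f | F]) ω ≤ (μ[g | F]) ω := by
  have h1 : s.indicator f ≤ᵐ[μ] s.indicator g := by
    filter_upwards [h] with ω hω
    by_cases hs : ω ∈ s
    · simpa [hs] using hω hs
    · simp [hs]
  filter_upwards [condExp_mono (m := F) (hf.indicator (hF s hs)) (hg.indicator (hF s hs)) h1,
    condExp_indicator hf hs, condExp_indicator hg hs] with ω h2 h3 h4 hω
  rw [h3, h4] at h2
  simpa [hω] using h2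

theorem condExp_eq_condExp_on {f g : Ω → ℝ} {s : Set Ω}
    (hf : Integrable f μ) (hg : Integrable g μ) (hF : F ≤ m0) (hs : MeasurableSet[F] s)
    (h : ∀ᵐ ω ∂μ, ω ∈ s → f ω = g ω) : ∀ᵐ ω ∂μ, ω ∈ s → (μ[f | F]) ω = (μ[g | F]) ω := by
  filter_upwards [condExp_le_condExp_on hf hg hF hs (h.mono fun ω h hs => (h hs).le),
    condExp_le_condExp_on hg hf hF hs (h.mono fun ω h hs => (h hs).ge)] with ω h1 h2 hs
  exact le_antisymm (h1 hs) (h2 hs)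

/-- Adding to `X` a centred variable `W` that is independent of the past `H` (which determines
`X` and contains the conditioning `σ`-algebra `F`) adds the variance of `W` to the conditional
second moment. -/
theorem condExp_add_sq_of_indep [IsProbabilityMeasure μ] (hFH : F ≤ H)
    (hH : H ≤ m0) {X W : Ω → ℝ} (hX : Measurable[H] X) (hX2 : MemLp X 2 μ) (hW : Measurable W)
    (hW2 : MemLp W 2 μ) (hW0 : ∫ ω, W ω ∂μ = 0)
    (hind : Indep (MeasurableSpace.comap W inferInstance) H μ) :
    μ[fun ω => (X ω + W ω) ^ 2 | F]
      =ᵐ[μ] fun ω => (μ[fun ω => X ω ^ 2 | F]) ω + ∫ ω, W ω ^ 2 ∂μ := by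
  have hF : F ≤ m0 := hFH.trans hH
  have hXX : Integrable (fun ω => X ω ^ 2) μ := hX2.integrable_sq
  have hWW : Integrable (fun ω => W ω ^ 2) μ := hW2.integrable_sq
  have hXW : Integrable (X * W) μ := hX2.integrable_mul hW2
  have hcross : μ[X * W | F] =ᵐ[μ] 0 := by
    have h1 : μ[X * W | H] =ᵐ[μ] 0 := by
      refine (condExp_mul_of_stronglyMeasurable_left hX.stronglyMeasurable hXW
        (hW2.integrable one_le_two)).trans ?_
      have h2 := condExp_indep_eq (μ := μ) (f := W) hW.comap_le hH
        (comap_measurable W).stronglyMeasurable hind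
      filter_upwards [h2] with ω h3
      simp [h3, hW0]
    refine (condExp_condExp_of_le hFH hH).symm.trans ((condExp_congr_ae h1).trans ?_)
    rw [condExp_zero]
  have hsq : μ[fun ω => W ω ^ 2 | F] =ᵐ[μ] fun _ => ∫ ω, W ω ^ 2 ∂μ :=
    condExp_indep_eq hW.comap_le hF ((comap_measurable W).pow_const 2).stronglyMeasurable
      (indep_of_indep_of_le_right hind hFH)
  have hsplit : (fun ω => (X ω + W ω) ^ 2)
      = ((fun ω => X ω ^ 2) + (2 : ℝ) • (X * W)) + fun ω => W ω ^ 2 := by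
    ext ω; simp only [Pi.add_apply, Pi.smul_apply, Pi.mul_apply, smul_eq_mul]; ring
  rw [hsplit]
  filter_upwards [condExp_add (hXX.add (hXW.smul (2 : ℝ))) hWW F,
    condExp_add hXX (hXW.smul (2 : ℝ)) F, condExp_smul (2 : ℝ) (X * W) F, hcross, hsq]
    with ω h1 h2 h3 h4 h5
  rw [h1, Pi.add_apply, h2, Pi.add_apply, h3, Pi.smul_apply, h4, h5]
  simp

theorem condExp_sum_ae_eq {ι : Type*} (s : Finset ι) {f : ι → Ω → ℝ}
    (hf : ∀ i ∈ s, Integrable (f i) μ) :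
    μ[fun ω => ∑ i ∈ s, f i ω | F] =ᵐ[μ] fun ω => ∑ i ∈ s, (μ[f i | F]) ω := by
  have h := condExp_finsetSum hf F
  have h1 : (∑ i ∈ s, f i) = fun ω => ∑ i ∈ s, f i ω := by ext ω; simp
  rw [h1] at h
  filter_upwards [h] with ω h2
  rw [h2]; simp

/-- The conditional second moment of a linear combination, in terms of the matrix of conditional
second moments. -/
theorem condExp_sq_dotProduct {ι : Type*} [Fintype ι] {X : Ω → ι → ℝ}
    (hX : ∀ j, MemLp (fun ω => X ω j) 2 μ) (a : ι → ℝ) :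
    μ[fun ω => (a ⬝ᵥ X ω) ^ 2 | F]
      =ᵐ[μ] fun ω => a ⬝ᵥ ((Matrix.of fun i j => (μ[fun ω => X ω i * X ω j | F]) ω) *ᵥ a) := by
  have hint : ∀ i j, Integrable (fun ω => X ω i * X ω j) μ :=
    fun i j => (hX i).integrable_mul (hX j)
  have hsplit : (fun ω => (a ⬝ᵥ X ω) ^ 2)
      = fun ω => ∑ i, ∑ j, ((a i * a j) • fun ω => X ω i * X ω j) ω := by
    ext ω
    simp only [dotProduct, sq, Finset.sum_mul_sum, Pi.smul_apply, smul_eq_mul]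
    exact Finset.sum_congr rfl fun _ _ => Finset.sum_congr rfl fun _ _ => by ring
  rw [hsplit]
  have h1 := condExp_sum_ae_eq (μ := μ) (F := F) Finset.univ
    (f := fun i ω => ∑ j, ((a i * a j) • fun ω => X ω i * X ω j) ω)
    fun i _ => integrable_finsetSum _ fun j _ => (hint i j).smul _
  have h2 : ∀ᵐ ω ∂μ, ∀ i, (μ[fun ω => ∑ j, ((a i * a j) • fun ω => X ω i * X ω j) ω | F]) ω
      = ∑ j, (μ[(a i * a j) • fun ω => X ω i * X ω j | F]) ω :=
    ae_all_iff.2 fun i => condExp_sum_ae_eq (μ := μ) (F := F) Finset.univ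
      fun j _ => (hint i j).smul (a i * a j)
  have h3 : ∀ᵐ ω ∂μ, ∀ i j, (μ[(a i * a j) • fun ω => X ω i * X ω j | F]) ω
      = a i * a j * (μ[fun ω => X ω i * X ω j | F]) ω :=
    ae_all_iff.2 fun i => ae_all_iff.2 fun j => by
      filter_upwards [condExp_smul (μ := μ) (a i * a j) (fun ω => X ω i * X ω j) F] with ω h
      rw [h]; rfl
  filter_upwards [h1, h2, h3] with ω h1 h2 h3
  rw [h1]
  simp only [h2, h3, dotProduct, Matrix.mulVec, Matrix.of_apply, Finset.mul_sum]
  exact Finset.sum_congr rfl fun _ _ => Finset.sum_congr rfl fun _ _ => by ring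

/-- If `X` is independent of the pair `(Y, Z)` and `Y` of `Z`, then `(X, Y)` is independent
of `Z`. -/
theorem indepFun_prodMk_of_indepFun [IsProbabilityMeasure μ] {α β γ : Type*} [MeasurableSpace α]
    [MeasurableSpace β] [MeasurableSpace γ] {X : Ω → α} {Y : Ω → β} {Z : Ω → γ}
    (hX : Measurable X) (hY : Measurable Y) (hZ : Measurable Z)
    (h : IndepFun X (fun ω => (Y ω, Z ω)) μ) (h' : IndepFun Y Z μ) :
    IndepFun (fun ω => (X ω, Y ω)) Z μ := by
  have hXY : IndepFun X Y μ := h.comp measurable_id measurable_fst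
  have := Measure.isProbabilityMeasure_map (μ := μ) hX.aemeasurable
  have := Measure.isProbabilityMeasure_map (μ := μ) hY.aemeasurable
  have := Measure.isProbabilityMeasure_map (μ := μ) hZ.aemeasurable
  rw [indepFun_iff_map_prod_eq_prod_map_map hX.aemeasurable (hY.prodMk hZ).aemeasurable,
    (indepFun_iff_map_prod_eq_prod_map_map hY.aemeasurable hZ.aemeasurable).1 h'] at h
  rw [indepFun_iff_map_prod_eq_prod_map_map (hX.prodMk hY).aemeasurable hZ.aemeasurable,
    (indepFun_iff_map_prod_eq_prod_map_map hX.aemeasurable hY.aemeasurable).1 hXY]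
  apply MeasurableEquiv.prodAssoc.map_measurableEquiv_injective
  rw [Measure.prodAssoc_prod, ← h, Measure.map_map (by fun_prop) (by fun_prop)]
  rfl

end Conditioning

/-! ### The random walk and the observations -/

theorem eq_of_lastAdd_le (N : ℕ → Finset (Fin m)) {t s : ℕ} (hs : lastAdd N t ≤ s) (hst : s ≤ t) :
    N s = N t := by
  induction t, hst using Nat.le_induction with
  | base => rfl
  | succ r hr ih =>
    have hg : Nat.findGreatest (fun τ => 1 ≤ τ ∧ N (τ - 1) ≠ N τ) (r + 1) < r + 1 := by
      have := le_max_right 1 (Nat.findGreatest (fun τ => 1 ≤ τ ∧ N (τ - 1) ≠ N τ) (r + 1))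
      unfold lastAdd at hs
      omega
    have h1 := Nat.findGreatest_is_greatest hg le_rfl
    have h2 : N r = N (r + 1) := by simpa using h1
    rw [← h2]
    refine ih (le_trans ?_ hs)
    refine max_le_max le_rfl (Nat.findGreatest_mono_right _ (Nat.le_succ r))

theorem one_le_lastAdd (N : ℕ → Finset (Fin m)) (t : ℕ) : 1 ≤ lastAdd N t := le_max_left _ _

theorem lastAdd_le (N : ℕ → Finset (Fin m)) {t : ℕ} (ht : 1 ≤ t) : lastAdd N t ≤ t :=
  max_le ht (Nat.findGreatest_le t)

section Model

variable {A : Matrix (Fin n) (Fin m) ℝ} {σobs σsys : ℝ} {Smax Sfa : ℕ} {N : ℕ → Finset (Fin m)}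
  {Ω : Type*} [mΩ : MeasurableSpace Ω] {μ : Measure Ω}
  {x ν : ℕ → Ω → Fin m → ℝ} {y w : ℕ → Ω → Fin n → ℝ} {T : ℕ → Ω → Finset (Fin m)}

theorem Model.x_eq_sum (hm : Model A σobs σsys Smax Sfa N μ x ν y w T) (t : ℕ) :
    x t = fun ω => ∑ s ∈ Finset.range t, ν (s + 1) ω := by
  induction t with
  | zero => ext1 ω; simp [hm.x_zero]
  | succ t ih => ext1 ω; rw [hm.x_succ, ih, Finset.sum_range_succ]

theorem Model.x_apply (hm : Model A σobs σsys Smax Sfa N μ x ν y w T) (t : ℕ) (ω : Ω) (j : Fin m) :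
    x t ω j = ∑ s ∈ Finset.range t, ν (s + 1) ω j := by
  rw [hm.x_eq_sum]
  exact Finset.sum_apply _ _ _

theorem Model.x_coord (hm : Model A σobs σsys Smax Sfa N μ x ν y w T) (t : ℕ) (j : Fin m) :
    (fun ω => x t ω j) = ∑ s ∈ Finset.range t, fun ω => ν (s + 1) ω j := by
  ext ω
  rw [hm.x_apply, Finset.sum_apply]

theorem Model.x_meas (hm : Model A σobs σsys Smax Sfa N μ x ν y w T) (t : ℕ) :
    Measurable (x t) := by
  rw [hm.x_eq_sum]
  exact Finset.measurable_fun_sum _ fun s _ => hm.ν_meas s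

theorem Model.y_meas (hm : Model A σobs σsys Smax Sfa N μ x ν y w T) (t : ℕ) :
    Measurable (y (t + 1)) := by
  have h : y (t + 1) = fun ω => A *ᵥ x (t + 1) ω + w (t + 1) ω := funext fun ω => hm.y_eq t ω
  rw [h]
  have h1 := hm.x_meas (t + 1)
  have h2 := hm.w_meas t
  have h3 : Measurable fun v : Fin m → ℝ => A *ᵥ v := by fun_prop
  exact (h3.comp h1).add h2

theorem Model.obsSigma_le (hm : Model A σobs σsys Smax Sfa N μ x ν y w T) (k : ℕ) :
    obsSigma y k ≤ mΩ := by
  refine iSup₂_le fun s hs => ?_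
  obtain ⟨r, rfl⟩ : ∃ r, s = r + 1 := ⟨s - 1, by have := (Finset.mem_Icc.1 hs).1; omega⟩
  exact (hm.y_meas r).comap_le

theorem Model.map_ν_apply (hm : Model A σobs σsys Smax Sfa N μ x ν y w T) (t : ℕ) (j : Fin m) :
    μ.map (fun ω => ν (t + 1) ω j)
      = gaussianReal 0 (if j ∈ N (t + 1) then (σsys ^ 2).toNNReal else 0) := by
  have h1 := (measurePreserving_eval (fun i : Fin m =>
    gaussianReal 0 (if i ∈ N (t + 1) then (σsys ^ 2).toNNReal else 0)) j).map_eq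
  rw [← hm.ν_law t, Measure.map_map (measurable_pi_apply j) (hm.ν_meas t)] at h1
  exact h1

theorem Model.ν_apply_meas (hm : Model A σobs σsys Smax Sfa N μ x ν y w T) (t : ℕ) (j : Fin m) :
    Measurable fun ω => ν (t + 1) ω j := (measurable_pi_apply j).comp (hm.ν_meas t)

theorem Model.ν_memLp (hm : Model A σobs σsys Smax Sfa N μ x ν y w T) (t : ℕ) (j : Fin m) :
    MemLp (fun ω => ν (t + 1) ω j) 2 μ := by
  have h1 : MemLp id 2 (μ.map fun ω => ν (t + 1) ω j) := by
    rw [hm.map_ν_apply]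
    exact_mod_cast memLp_id_gaussianReal 2
  exact h1.comp_of_map (hm.ν_apply_meas t j).aemeasurable

theorem Model.ν_mean (hm : Model A σobs σsys Smax Sfa N μ x ν y w T) (t : ℕ) (j : Fin m) :
    ∫ ω, ν (t + 1) ω j ∂μ = 0 := by
  have h1 := integral_map (μ := μ) (hm.ν_apply_meas t j).aemeasurable
    (f := id) aestronglyMeasurable_id
  rw [hm.map_ν_apply] at h1
  simp only [id] at h1
  rw [← h1]
  exact integral_id_gaussianReal

theorem Model.ν_variance (hm : Model A σobs σsys Smax Sfa N μ x ν y w T) (t : ℕ) (j : Fin m) :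
    variance (fun ω => ν (t + 1) ω j) μ = if j ∈ N (t + 1) then σsys ^ 2 else 0 := by
  have h1 := variance_map (μ := μ) (Y := fun ω => ν (t + 1) ω j) (X := id) aemeasurable_id
    (hm.ν_apply_meas t j).aemeasurable
  rw [hm.map_ν_apply, variance_id_gaussianReal] at h1
  have h2 : (id ∘ fun ω => ν (t + 1) ω j) = fun ω => ν (t + 1) ω j := rfl
  rw [h2] at h1
  rw [← h1]
  split_ifs <;> simp [Real.coe_toNNReal _ (sq_nonneg σsys)]

theorem Model.x_memLp (hm : Model A σobs σsys Smax Sfa N μ x ν y w T) (t : ℕ) (j : Fin m) :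
    MemLp (fun ω => x t ω j) 2 μ := by
  rw [hm.x_coord]
  exact memLp_finsetSum' _ fun s _ => hm.ν_memLp s j

theorem Model.N_subset (hm : Model A σobs σsys Smax Sfa N μ x ν y w T) {s t : ℕ} (h : s ≤ t) :
    N s ⊆ N t := monotone_nat_of_le_succ (f := N) hm.N_mono h

/-- The state is supported on `N_t`: the increments off `N_t` have variance `0`. -/
theorem Model.x_eq_zero (hm : Model A σobs σsys Smax Sfa N μ x ν y w T) (t : ℕ) :
    ∀ᵐ ω ∂μ, ∀ j ∉ N t, x t ω j = 0 := by
  have h1 : ∀ᵐ ω ∂μ, ∀ s j, j ∉ N (s + 1) → ν (s + 1) ω j = 0 := by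
    refine ae_all_iff.2 fun s => ae_all_iff.2 fun j => ?_
    by_cases hj : j ∈ N (s + 1)
    · exact ae_of_all _ fun ω h => absurd hj h
    · have h2 := hm.map_ν_apply s j
      rw [if_neg hj, gaussianReal_zero_var] at h2
      have h3 : ∀ᵐ z ∂(μ.map fun ω => ν (s + 1) ω j), z = 0 := by
        rw [h2, ae_dirac_eq, Filter.eventually_pure]
      exact (ae_of_ae_map (hm.ν_apply_meas s j).aemeasurable h3).mono fun ω h _ => h
  filter_upwards [h1] with ω hω j hj
  rw [hm.x_apply]
  refine Finset.sum_eq_zero fun s hs => hω s j fun h => hj (hm.N_subset ?_ h)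
  have := Finset.mem_range.1 hs
  omega

theorem Model.noise_memLp (hm : Model A σobs σsys Smax Sfa N μ x ν y w T) (k : ℕ) (r : Fin n → ℝ) :
    MemLp (fun ω => r ⬝ᵥ w (k + 1) ω) 2 μ :=
  memLp_finsetSum _ fun i _ => (hm.w_memLp k i).const_mul (r i)

theorem Model.noise_sq (hm : Model A σobs σsys Smax Sfa N μ x ν y w T) (k : ℕ) (r : Fin n → ℝ) :
    ∫ ω, (r ⬝ᵥ w (k + 1) ω) ^ 2 ∂μ = σobs ^ 2 * sqNorm r := by
  have hint : ∀ i j, Integrable (fun ω => r i * r j * (w (k + 1) ω i * w (k + 1) ω j)) μ :=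
    fun i j => ((hm.w_memLp k i).integrable_mul (hm.w_memLp k j)).const_mul _
  have hsplit : (fun ω => (r ⬝ᵥ w (k + 1) ω) ^ 2)
      = fun ω => ∑ i, ∑ j, r i * r j * (w (k + 1) ω i * w (k + 1) ω j) := by
    ext ω
    simp only [dotProduct, sq, Finset.sum_mul_sum]
    exact Finset.sum_congr rfl fun _ _ => Finset.sum_congr rfl fun _ _ => by ring
  rw [hsplit, integral_finsetSum _ fun i _ => integrable_finsetSum _ fun j _ => hint i j]
  simp only [integral_finsetSum _ fun j _ => hint _ j, integral_const_mul, hm.w_cov]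
  simp only [mul_ite, mul_zero, Finset.sum_ite_eq, Finset.mem_univ, if_true, sqNorm,
    Finset.mul_sum]
  exact Finset.sum_congr rfl fun _ _ => by ring

theorem Model.signal_memLp (hm : Model A σobs σsys Smax Sfa N μ x ν y w T) (t : ℕ)
    (a : Fin m → ℝ) : MemLp (fun ω => a ⬝ᵥ x t ω) 2 μ :=
  memLp_finsetSum _ fun i _ => (hm.x_memLp t i).const_mul (a i)

/-- The `σ`-algebra generated by all the increments `ν_1, ν_2, …` and by the noise vectors
`w_1, …, w_k`. -/
abbrev history {Ω : Type*} (ν : ℕ → Ω → Fin m → ℝ) (w : ℕ → Ω → Fin n → ℝ) (k : ℕ) :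
    MeasurableSpace Ω :=
  MeasurableSpace.comap
    (fun ω => ((fun s => ν (s + 1) ω : ℕ → Fin m → ℝ),
      (fun s => w (s + 1) ω : Finset.range k → Fin n → ℝ))) inferInstance

theorem measurable_history {Ω : Type*} (ν : ℕ → Ω → Fin m → ℝ) (w : ℕ → Ω → Fin n → ℝ) (k : ℕ) :
    Measurable[history ν w k] (fun ω => ((fun s => ν (s + 1) ω : ℕ → Fin m → ℝ),
      (fun s => w (s + 1) ω : Finset.range k → Fin n → ℝ))) :=
  comap_measurable _

theorem Model.history_meas (hm : Model A σobs σsys Smax Sfa N μ x ν y w T) (k : ℕ) :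
    Measurable (fun ω => ((fun s => ν (s + 1) ω : ℕ → Fin m → ℝ),
      (fun s => w (s + 1) ω : Finset.range k → Fin n → ℝ))) :=
  (measurable_pi_lambda _ fun s => hm.ν_meas s).prodMk (measurable_pi_lambda _ fun s => hm.w_meas s)

theorem Model.history_le (hm : Model A σobs σsys Smax Sfa N μ x ν y w T) (k : ℕ) :
    history ν w k ≤ mΩ := (hm.history_meas k).comap_le

theorem Model.obsSigma_le_history (hm : Model A σobs σsys Smax Sfa N μ x ν y w T) (k : ℕ) :
    obsSigma y k ≤ history ν w k := by
  refine iSup₂_le fun s hs => ?_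
  obtain ⟨r, rfl⟩ : ∃ r, s = r + 1 := ⟨s - 1, by have := (Finset.mem_Icc.1 hs).1; omega⟩
  have hr : r ∈ Finset.range k := by
    have := (Finset.mem_Icc.1 hs).2
    exact Finset.mem_range.2 (by omega)
  have hg : Measurable (fun p : (ℕ → Fin m → ℝ) × (Finset.range k → Fin n → ℝ) =>
      A *ᵥ (∑ i ∈ Finset.range (r + 1), p.1 i) + p.2 ⟨r, hr⟩) := by
    have h3 : Measurable fun v : Fin m → ℝ => A *ᵥ v := by fun_prop
    exact (h3.comp (Finset.measurable_fun_sum _ fun s _ => by fun_prop)).add (by fun_prop)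
  refine Measurable.comap_le ?_
  convert hg.comp (measurable_history ν w k) using 1
  ext1 ω
  rw [hm.y_eq, hm.x_eq_sum]
  rfl

theorem Model.x_meas_history (hm : Model A σobs σsys Smax Sfa N μ x ν y w T) (k t : ℕ) :
    Measurable[history ν w k] (x t) := by
  have hg : Measurable (fun p : (ℕ → Fin m → ℝ) × (Finset.range k → Fin n → ℝ) =>
      ∑ i ∈ Finset.range t, p.1 i) := Finset.measurable_fun_sum _ fun s _ => by fun_prop
  rw [hm.x_eq_sum]
  exact hg.comp (measurable_history ν w k)

variable [IsProbabilityMeasure μ]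

/-- A coordinate in `N_t` has received an increment at each time since the last addition. -/
theorem Model.le_integral_x_sq (hm : Model A σobs σsys Smax Sfa N μ x ν y w T) {t : ℕ} (ht : 1 ≤ t)
    {j : Fin m} (hj : j ∈ N t) :
    ((t : ℝ) - lastAdd N t + 1) * σsys ^ 2 ≤ ∫ ω, x t ω j ^ 2 ∂μ := by
  have hmean : ∫ ω, x t ω j ∂μ = 0 := by
    simp only [hm.x_apply]
    rw [integral_finsetSum _ fun s _ => (hm.ν_memLp s j).integrable one_le_two]
    exact Finset.sum_eq_zero fun s _ => hm.ν_mean s j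
  have hvar : variance (fun ω => x t ω j) μ
      = ∑ s ∈ Finset.range t, if j ∈ N (s + 1) then σsys ^ 2 else 0 := by
    rw [hm.x_coord, IndepFun.variance_sum (fun s _ => hm.ν_memLp s j)]
    · exact Finset.sum_congr rfl fun s _ => hm.ν_variance s j
    · intro s _ r _ hsr
      exact (hm.ν_indep.indepFun hsr).comp (measurable_pi_apply j) (measurable_pi_apply j)
  rw [← variance_of_integral_eq_zero (hm.x_memLp t j).aemeasurable hmean, hvar]
  have h1 := one_le_lastAdd N t
  have h2 := lastAdd_le N ht
  calc ((t : ℝ) - lastAdd N t + 1) * σsys ^ 2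
      = ∑ _s ∈ Finset.Ico (lastAdd N t - 1) t, σsys ^ 2 := by
        rw [Finset.sum_const, Nat.card_Ico, nsmul_eq_mul, Nat.cast_sub (by omega),
          Nat.cast_sub h1]
        push_cast; ring
    _ = ∑ s ∈ Finset.Ico (lastAdd N t - 1) t, if j ∈ N (s + 1) then σsys ^ 2 else 0 := by
        refine Finset.sum_congr rfl fun s hs => ?_
        rw [Finset.mem_Ico] at hs
        rw [eq_of_lastAdd_le N (t := t) (s := s + 1) (by omega) (by omega), if_pos hj]
    _ ≤ _ := by
        refine Finset.sum_le_sum_of_subset_of_nonneg ?_ fun s _ _ => ?_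
        · intro s hs
          exact Finset.mem_range.2 (Finset.mem_Ico.1 hs).2
        · split_ifs <;> positivity

/-- The noise at time `k + 1` is independent of the history, hence of the state at time `k + 1`
and of the observations up to time `k` together. -/
theorem Model.indep_history (hm : Model A σobs σsys Smax Sfa N μ x ν y w T) (k : ℕ) :
    Indep (MeasurableSpace.comap (w (k + 1)) inferInstance) (history ν w k) μ := by
  have h1 : IndepFun (fun ω => (fun s => w (s + 1) ω : Finset.range k → Fin n → ℝ))
      (w (k + 1)) μ := by
    have h := hm.w_indep.indepFun_finset (Finset.range k) {k} (by simp) hm.w_meas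
    have hp : Measurable fun p : ({k} : Finset ℕ) → Fin n → ℝ =>
      p ⟨k, Finset.mem_singleton_self k⟩ := by fun_prop
    exact h.comp measurable_id hp
  have hp : Measurable fun p : ℕ → Fin n → ℝ =>
      ((fun s => p s : Finset.range k → Fin n → ℝ), p k) := by fun_prop
  have h2 : IndepFun (fun ω s => ν (s + 1) ω)
      (fun ω => ((fun s => w (s + 1) ω : Finset.range k → Fin n → ℝ), w (k + 1) ω)) μ :=
    hm.ν_w_indep.comp measurable_id hp
  have hV : Measurable fun ω s => ν (s + 1) ω := measurable_pi_lambda _ fun s => hm.ν_meas s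
  have hY : Measurable fun ω => (fun s => w (s + 1) ω : Finset.range k → Fin n → ℝ) :=
    measurable_pi_lambda _ fun s => hm.w_meas s
  exact (indepFun_prodMk_of_indepFun hV hY (hm.w_meas k) h2 h1).symm

theorem Model.noise_mean (hm : Model A σobs σsys Smax Sfa N μ x ν y w T) (k : ℕ) (r : Fin n → ℝ) :
    ∫ ω, r ⬝ᵥ w (k + 1) ω ∂μ = 0 := by
  simp only [dotProduct]
  rw [integral_finsetSum _ fun i _ => ((hm.w_memLp k i).integrable one_le_two).const_mul (r i)]
  refine Finset.sum_eq_zero fun i _ => ?_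
  rw [integral_const_mul, hm.w_mean, mul_zero]

theorem Model.condExp_signal_add_noise_sq (hm : Model A σobs σsys Smax Sfa N μ x ν y w T) (k : ℕ)
    (a : Fin m → ℝ) (r : Fin n → ℝ) :
    μ[fun ω => (a ⬝ᵥ x (k + 1) ω + r ⬝ᵥ w (k + 1) ω) ^ 2 | obsSigma y k]
      =ᵐ[μ] fun ω => (μ[fun ω => (a ⬝ᵥ x (k + 1) ω) ^ 2 | obsSigma y k]) ω
        + σobs ^ 2 * sqNorm r := by
  rw [← hm.noise_sq k r]
  have ha : Measurable fun v : Fin m → ℝ => a ⬝ᵥ v := by unfold dotProduct; fun_prop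
  have hr : Measurable fun v : Fin n → ℝ => r ⬝ᵥ v := by unfold dotProduct; fun_prop
  refine condExp_add_sq_of_indep (hm.obsSigma_le_history k) (hm.history_le k)
    (ha.comp (hm.x_meas_history k _)) (hm.signal_memLp _ a) (hr.comp (hm.w_meas k))
    (hm.noise_memLp k r) (hm.noise_mean k r) (indep_of_indep_of_le_left (hm.indep_history k) ?_)
  exact (hr.comp (comap_measurable (w (k + 1)))).comap_le

end Model

section Model

variable {A : Matrix (Fin n) (Fin m) ℝ} {σobs σsys : ℝ} {Smax Sfa : ℕ} {N : ℕ → Finset (Fin m)}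
  {Ω : Type*} [mΩ : MeasurableSpace Ω] {μ : Measure Ω}
  {x ν : ℕ → Ω → Fin m → ℝ} {y w : ℕ → Ω → Fin n → ℝ} {T : ℕ → Ω → Finset (Fin m)}

/-! ### The residual for a fixed support estimate -/

/-- The residual at time `t` when the support estimate is the fixed set `U`. -/
def residOn (A : Matrix (Fin n) (Fin m) ℝ) (x : ℕ → Ω → Fin m → ℝ) (y : ℕ → Ω → Fin n → ℝ)
    (t : ℕ) (U : Finset (Fin m)) (ω : Ω) : Fin m → ℝ :=
  x t ω - lsEst A U (y t ω)

theorem Model.y_memLp (hm : Model A σobs σsys Smax Sfa N μ x ν y w T) (k : ℕ) (l : Fin n) :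
    MemLp (fun ω => y (k + 1) ω l) 2 μ := by
  have h : (fun ω => y (k + 1) ω l) = fun ω => A l ⬝ᵥ x (k + 1) ω + w (k + 1) ω l := by
    ext ω; rw [hm.y_eq]; rfl
  rw [h]
  exact (hm.signal_memLp (k + 1) (A l)).add (hm.w_memLp k l)

theorem Model.residOn_memLp (hm : Model A σobs σsys Smax Sfa N μ x ν y w T) (k : ℕ)
    (U : Finset (Fin m)) (i : Fin m) : MemLp (fun ω => residOn A x y (k + 1) U ω i) 2 μ := by
  have h : (fun ω => residOn A x y (k + 1) U ω i)
      = fun ω => x (k + 1) ω i - lsMat A U i ⬝ᵥ y (k + 1) ω := by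
    ext ω; rw [residOn, Pi.sub_apply, lsEst_eq_mulVec]; rfl
  rw [h]
  exact (hm.x_memLp (k + 1) i).sub
    (memLp_finsetSum _ fun l _ => (hm.y_memLp k l).const_mul (lsMat A U i l))

theorem Model.integrable_residOn_sq (hm : Model A σobs σsys Smax Sfa N μ x ν y w T) (k : ℕ)
    (U : Finset (Fin m)) (i : Fin m) : Integrable (fun ω => residOn A x y (k + 1) U ω i ^ 2) μ :=
  (hm.residOn_memLp k U i).integrable_sq

theorem Model.measurableSet_eq (hm : Model A σobs σsys Smax Sfa N μ x ν y w T) (k : ℕ)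
    (U : Finset (Fin m)) : MeasurableSet {ω | T k ω = U} :=
  hm.obsSigma_le k _ (hm.T_adapted k U)

omit mΩ in
theorem resid_eq_sum (k : ℕ) (i : Fin m) : (fun ω => resid A x y T (k + 1) ω i)
    = fun ω => ∑ U, {ω | T k ω = U}.indicator (fun ω => residOn A x y (k + 1) U ω i) ω := by
  ext ω
  rw [Finset.sum_eq_single (T k ω)]
  · rw [Set.indicator_of_mem (by rfl)]; rfl
  · intro U _ hU
    exact Set.indicator_of_notMem (fun h => hU h.symm) _
  · simp

theorem Model.resid_memLp (hm : Model A σobs σsys Smax Sfa N μ x ν y w T) (k : ℕ) (i : Fin m) :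
    MemLp (fun ω => resid A x y T (k + 1) ω i) 2 μ := by
  rw [resid_eq_sum]
  exact memLp_finsetSum _ fun U _ => (hm.residOn_memLp k U i).indicator (hm.measurableSet_eq k U)

theorem Model.ae_ricDelta_lt (hm : Model A σobs σsys Smax Sfa N μ x ν y w T) (k : ℕ) :
    ∀ᵐ ω ∂μ, ricDelta A (T k ω).card < 1 := by
  filter_upwards [hm.T_false k] with ω hω
  refine (ricDelta_mono A ?_).trans_lt hm.delta_lt
  have h1 := Finset.card_le_card (show T k ω ⊆ N k ∪ (T k ω \ N k) from fun i hi => by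
    by_cases h : i ∈ N k <;> simp [h, hi])
  have h2 := Finset.card_union_le (N k) (T k ω \ N k)
  have h3 := hm.N_card k
  omega

theorem Model.residOn_of_mem (hm : Model A σobs σsys Smax Sfa N μ x ν y w T) (k : ℕ)
    {U : Finset (Fin m)} (hU : ricDelta A U.card < 1) : ∀ᵐ ω ∂μ, ∀ i ∈ U,
      residOn A x y (k + 1) U ω i = -(leakRow A U (N (k + 1) \ U) i ⬝ᵥ x (k + 1) ω
        + lsMat A U i ⬝ᵥ w (k + 1) ω) := by
  filter_upwards [hm.x_eq_zero (k + 1)] with ω hω i hi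
  rw [residOn, Pi.sub_apply, hm.y_eq]
  refine residual_apply_of_mem A hU Finset.disjoint_sdiff (fun j hj => hω j fun h => hj ?_) _ hi
  by_cases hjU : j ∈ U <;> simp [hjU, h]

omit mΩ in
theorem residOn_of_notMem (t : ℕ) {U : Finset (Fin m)} {i : Fin m} (hi : i ∉ U) (ω : Ω) :
    residOn A x y t U ω i = x t ω i := by
  rw [residOn, Pi.sub_apply, lsEst_eq_zero_of_notMem A hi, sub_zero]

variable [IsProbabilityMeasure μ]

theorem Model.condExp_residOn_sq (hm : Model A σobs σsys Smax Sfa N μ x ν y w T) (k : ℕ)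
    {U : Finset (Fin m)} (hU : ricDelta A U.card < 1) {i : Fin m} (hi : i ∈ U) :
    μ[fun ω => residOn A x y (k + 1) U ω i ^ 2 | obsSigma y k] =ᵐ[μ]
      fun ω => (μ[fun ω => (leakRow A U (N (k + 1) \ U) i ⬝ᵥ x (k + 1) ω) ^ 2 | obsSigma y k]) ω
        + σobs ^ 2 * sqNorm (lsMat A U i) := by
  refine Filter.EventuallyEq.trans (condExp_congr_ae ?_)
    (hm.condExp_signal_add_noise_sq k (leakRow A U (N (k + 1) \ U) i) (lsMat A U i))
  filter_upwards [hm.residOn_of_mem k hU] with ω hω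
  rw [hω i hi, neg_sq]

/-! ### Compressibility -/

theorem Model.condExp_residOn_sq_le (hm : Model A σobs σsys Smax Sfa N μ x ν y w T) (k : ℕ)
    {U : Finset (Fin m)} (hU : ricDelta A U.card < 1) {i : Fin m} (hi : i ∈ U) :
    ∀ᵐ ω ∂μ, (μ[fun ω => residOn A x y (k + 1) U ω i ^ 2 | obsSigma y k]) ω
      ≤ rocTheta A U.card (N (k + 1) \ U).card ^ 2 / (1 - ricDelta A U.card) ^ 2
          * lambdaMax (Matrix.of fun a b : (N (k + 1) \ U : Finset (Fin m)) =>
              (μ[fun ω => x (k + 1) ω a * x (k + 1) ω b | obsSigma y k]) ω)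
        + σobs ^ 2 / (1 - ricDelta A U.card) := by
  set D := N (k + 1) \ U with hD
  set q := leakRow A U D i with hq
  have hdot : ∀ v : Fin m → ℝ, q ⬝ᵥ v = (fun a : D => q a) ⬝ᵥ fun a : D => v a := by
    intro v
    simp only [dotProduct]
    rw [Finset.sum_coe_sort D fun a => q a * v a]
    exact (Finset.sum_subset (Finset.subset_univ D) fun j _ hj => by
      rw [hq, leakRow_eq_zero A U D i j hj, zero_mul]).symm
  have hnorm : sqNorm (fun a : D => q a) = sqNorm q := by
    rw [← dotProduct_self_eq_sqNorm, ← hdot, dotProduct_self_eq_sqNorm]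
  have h1 := condExp_sq_dotProduct (μ := μ) (F := obsSigma y k)
    (X := fun ω (a : D) => x (k + 1) ω a)
    (fun a => hm.x_memLp (k + 1) a) (fun a : D => q a)
  have h2 : ∀ᵐ ω ∂μ, ∀ a : D,
      0 ≤ (μ[fun ω => x (k + 1) ω a * x (k + 1) ω a | obsSigma y k]) ω :=
    ae_all_iff.2 fun a => condExp_nonneg (ae_of_all _ fun ω => mul_self_nonneg _)
  have hδ : 0 < 1 - ricDelta A U.card := sub_pos.2 hU
  filter_upwards [hm.condExp_residOn_sq k hU hi, h1, h2] with ω h3 h4 h5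
  rw [h3]
  refine add_le_add ?_ ?_
  · simp only [← hD, ← hq, hdot]
    rw [h4]
    have hherm : (Matrix.of fun a b : D =>
        (μ[fun ω => x (k + 1) ω a * x (k + 1) ω b | obsSigma y k]) ω).IsHermitian := by
      ext a b
      simp only [Matrix.conjTranspose_apply, Matrix.of_apply, star_trivial]
      simp only [mul_comm]
    refine (dotProduct_mulVec_le_lambdaMax hherm _).trans ?_
    rw [hnorm, mul_comm]
    exact mul_le_mul_of_nonneg_right (sqNorm_leakRow_le A hU Finset.disjoint_sdiff i)
      (lambdaMax_nonneg hherm h5)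
  · rw [div_eq_mul_one_div]
    exact mul_le_mul_of_nonneg_left (sqNorm_lsMat_row_le A hU i) (sq_nonneg _)

theorem Model.condSqResid_le_threshold (hm : Model A σobs σsys Smax Sfa N μ x ν y w T) (k : ℕ) :
    ∀ᵐ ω ∂μ, ∀ i ∈ T k ω,
      condSqResid A μ x y T (k + 1) i ω ≤ threshold A σobs N μ x y T (k + 1) ω := by
  have h1 : ∀ᵐ ω ∂μ, ∀ (U : Finset (Fin m)) (i : Fin m), T k ω = U →
      condSqResid A μ x y T (k + 1) i ω
        = (μ[fun ω => residOn A x y (k + 1) U ω i ^ 2 | obsSigma y k]) ω := by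
    refine ae_all_iff.2 fun U => ae_all_iff.2 fun i => ?_
    refine condExp_eq_condExp_on (hm.resid_memLp k i).integrable_sq (hm.integrable_residOn_sq k U i)
      (hm.obsSigma_le k) (hm.T_adapted k U) (ae_of_all _ fun ω hω => ?_)
    have hω' : T k ω = U := hω
    rw [← hω']; rfl
  have h2 : ∀ᵐ ω ∂μ, ∀ (U : Finset (Fin m)), ricDelta A U.card < 1 → ∀ i ∈ U, _ :=
    ae_all_iff.2 fun U => Filter.eventually_imp_distrib_left.2 fun hU =>
      ae_all_iff.2 fun i => Filter.eventually_imp_distrib_left.2 fun hi =>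
        hm.condExp_residOn_sq_le k hU hi
  filter_upwards [h1, h2, hm.ae_ricDelta_lt k] with ω h1 h2 h3 i hi
  rw [h1 _ i rfl]
  exact h2 (T k ω) h3 i hi

/-! ### The error of the Dantzig selector on the residual -/

/-- The conditional energy of the residual on a part `E` of the support estimate. -/
theorem Model.condExp_sum_residOn_sq_le (hm : Model A σobs σsys Smax Sfa N μ x ν y w T) (k : ℕ)
    {U : Finset (Fin m)} (hU : ricDelta A U.card < 1) {E : Finset (Fin m)} (hE : E ⊆ U) :
    ∀ᵐ ω ∂μ, (μ[fun ω => ∑ i ∈ E, residOn A x y (k + 1) U ω i ^ 2 | obsSigma y k]) ω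
      ≤ rocTheta A U.card (N (k + 1) \ U).card ^ 2 / (1 - ricDelta A U.card) ^ 2
          * (μ[fun ω => ∑ i ∈ N (k + 1) \ U, x (k + 1) ω i ^ 2 | obsSigma y k]) ω
        + E.card * (σobs ^ 2 / (1 - ricDelta A U.card)) := by
  set D := N (k + 1) \ U with hD
  set K := rocTheta A U.card D.card ^ 2 / (1 - ricDelta A U.card) ^ 2 with hK
  have hleak : ∀ i, Integrable (fun ω => (leakRow A U D i ⬝ᵥ x (k + 1) ω) ^ 2) μ :=
    fun i => (hm.signal_memLp (k + 1) _).integrable_sq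
  have hx : Integrable (fun ω => ∑ i ∈ D, x (k + 1) ω i ^ 2) μ :=
    integrable_finsetSum _ fun i _ => (hm.x_memLp (k + 1) i).integrable_sq
  have h1 := condExp_sum_ae_eq (μ := μ) (F := obsSigma y k) E
    (f := fun i ω => residOn A x y (k + 1) U ω i ^ 2) fun i _ => hm.integrable_residOn_sq k U i
  have h2 := condExp_sum_ae_eq (μ := μ) (F := obsSigma y k) E
    (f := fun i ω => (leakRow A U D i ⬝ᵥ x (k + 1) ω) ^ 2) fun i _ => hleak i
  have h3 := condExp_mono (m := obsSigma y k) (integrable_finsetSum E fun i _ => hleak i)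
    (hx.smul K) (ae_of_all _ fun ω =>
      sum_sq_leakRow_le A hU Finset.disjoint_sdiff E (x (k + 1) ω))
  have h4 : ∀ᵐ ω ∂μ, ∀ i, i ∈ E →
      (μ[fun ω => residOn A x y (k + 1) U ω i ^ 2 | obsSigma y k]) ω
        = (μ[fun ω => (leakRow A U D i ⬝ᵥ x (k + 1) ω) ^ 2 | obsSigma y k]) ω
          + σobs ^ 2 * sqNorm (lsMat A U i) :=
    ae_all_iff.2 fun i => Filter.eventually_imp_distrib_left.2 fun hi =>
      hm.condExp_residOn_sq k hU (hE hi)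
  filter_upwards [h1, h2, h3, h4, condExp_smul (μ := μ) K
    (fun ω => ∑ i ∈ D, x (k + 1) ω i ^ 2) (obsSigma y k)] with ω h1 h2 h3 h4 h5
  rw [h1, Finset.sum_congr rfl h4, Finset.sum_add_distrib, ← h2]
  refine add_le_add (h3.trans (le_of_eq ?_)) ?_
  · rw [h5]; rfl
  · rw [← nsmul_eq_mul]
    refine Finset.sum_le_card_nsmul _ _ _ fun i _ => ?_
    rw [div_eq_mul_one_div]
    exact mul_le_mul_of_nonneg_left (sqNorm_lsMat_row_le A hU i) (sq_nonneg _)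

/-- A set `F` of at most `S` indices outside of which the residual has little conditional energy.
It contains all undetected indices if there are at most `S` of them, and is completed by detected
ones; otherwise it consists of `S` undetected indices. -/
theorem Model.exists_index_set (hm : Model A σobs σsys Smax Sfa N μ x ν y w T) (k : ℕ)
    {U : Finset (Fin m)} (hU : ricDelta A U.card < 1) (S : ℕ) :
    ∃ F E : Finset (Fin m), F.card ≤ S ∧ E.card = U.card + (N (k + 1) \ U).card - S ∧
      (∀ i ∉ F, i ∈ U ∪ N (k + 1) → i ∈ E) ∧
      ∀ᵐ ω ∂μ, (μ[fun ω => ∑ i ∈ E, residOn A x y (k + 1) U ω i ^ 2 | obsSigma y k]) ω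
        ≤ L0 A σobs U.card (N (k + 1) \ U).card
          ((μ[fun ω => ∑ i ∈ N (k + 1) \ U, x (k + 1) ω i ^ 2 | obsSigma y k]) ω) S := by
  set D := N (k + 1) \ U with hD
  have hDU : Disjoint U D := Finset.disjoint_sdiff
  by_cases hS : D.card ≤ S
  · obtain ⟨G, hGU, hG⟩ := Finset.exists_subset_card_eq (s := U) (n := min (S - D.card) U.card)
      (min_le_right _ _)
    have hcard : (U \ G).card = U.card + D.card - S := by
      rw [Finset.card_sdiff_of_subset hGU, hG]; omega
    refine ⟨D ∪ G, U \ G, ?_, hcard, ?_, ?_⟩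
    · have := Finset.card_union_le D G
      omega
    · intro i hi hiU
      simp only [hD, Finset.mem_union, Finset.mem_sdiff] at *
      tauto
    · filter_upwards [hm.condExp_sum_residOn_sq_le k hU (E := U \ G) Finset.sdiff_subset] with ω hω
      rw [L0, if_pos hS, ← hcard]
      exact hω
  · push Not at hS
    obtain ⟨F, hFD, hF⟩ := Finset.exists_subset_card_eq hS.le
    have hdis : Disjoint U (D \ F) := hDU.mono_right Finset.sdiff_subset
    refine ⟨F, U ∪ D \ F, hF.le, ?_, ?_, ?_⟩
    · rw [Finset.card_union_of_disjoint hdis, Finset.card_sdiff_of_subset hFD, hF]; omega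
    · intro i hi hiU
      simp only [hD, Finset.mem_union, Finset.mem_sdiff] at *
      tauto
    · have hxi : ∀ B : Finset (Fin m), Integrable (fun ω => ∑ i ∈ B, x (k + 1) ω i ^ 2) μ :=
        fun B => integrable_finsetSum _ fun i _ => (hm.x_memLp (k + 1) i).integrable_sq
      have hui : Integrable (fun ω => ∑ i ∈ U, residOn A x y (k + 1) U ω i ^ 2) μ :=
        integrable_finsetSum _ fun i _ => hm.integrable_residOn_sq k U i
      have hle := condExp_mono (μ := μ) (m := obsSigma y k)
        (integrable_finsetSum (U ∪ D \ F) fun i _ => hm.integrable_residOn_sq k U i)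
        (hui.add (hxi D)) (ae_of_all _ fun ω => by
          simp only [Pi.add_apply]
          rw [Finset.sum_union hdis]
          refine add_le_add le_rfl ?_
          calc ∑ i ∈ D \ F, residOn A x y (k + 1) U ω i ^ 2
              = ∑ i ∈ D \ F, x (k + 1) ω i ^ 2 := Finset.sum_congr rfl fun i hi => by
                rw [residOn_of_notMem]
                exact Finset.disjoint_right.1 hdis hi
            _ ≤ _ := Finset.sum_le_sum_of_subset_of_nonneg Finset.sdiff_subset
                fun _ _ _ => sq_nonneg _)
      filter_upwards [hm.condExp_sum_residOn_sq_le k hU (E := U) subset_rfl, hle,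
        condExp_add hui (hxi D) (obsSigma y k)] with ω h1 h2 h3
      rw [L0, if_neg (not_le.2 hS)]
      rw [h3, Pi.add_apply] at h2
      linarith

theorem C3_nonneg (A : Matrix (Fin n) (Fin m) ℝ) (S : ℕ) : 0 ≤ C3 A S := by
  unfold C3; positivity

omit [IsProbabilityMeasure μ] in
/-- The residual signal is feasible for the Dantzig selector applied to `ỹ_t`, as the noise obeys
the bound defining feasibility. -/
theorem Model.ae_resid_feasible (hm : Model A σobs σsys Smax Sfa N μ x ν y w T) (k : ℕ) :
    ∀ᵐ ω ∂μ, DantzigFeasible A (lam m * σobs) (yRes A y T (k + 1) ω)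
      (resid A x y T (k + 1) ω) := by
  filter_upwards [hm.w_bdd k] with ω hω j
  have h1 : yRes A y T (k + 1) ω - A *ᵥ resid A x y T (k + 1) ω = w (k + 1) ω := by
    rw [yRes, resid, hm.y_eq, Matrix.mulVec_sub]; abel
  rw [h1]
  have hκ : 0 ≤ lam m * σobs := mul_nonneg (Real.sqrt_nonneg _) hm.σobs_nonneg
  -- compare with the largest entry of the noise
  rcases isEmpty_or_nonempty (Fin n) with he | hne
  · simpa [Matrix.mulVec, dotProduct] using hκ
  obtain ⟨l, -, hl⟩ := Finset.exists_max_image Finset.univ (fun l => |w (k + 1) ω l|)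
    Finset.univ_nonempty
  refine le_trans ?_ (hω l j)
  simp only [Matrix.mulVec, dotProduct, Matrix.transpose_apply, l1Norm, Finset.mul_sum]
  refine (Finset.abs_sum_le_sum_abs _ _).trans (Finset.sum_le_sum fun i _ => ?_)
  rw [abs_mul, mul_comm]
  exact mul_le_mul_of_nonneg_right (hl i (Finset.mem_univ i)) (abs_nonneg _)

theorem sqNorm_le_l1Norm_sq (v : Fin m → ℝ) : sqNorm v ≤ l1Norm v ^ 2 := by
  have : sqNorm v = ∑ i, |v i| ^ 2 := by simp [sqNorm]
  rw [this]
  exact Finset.sum_sq_le_sq_sum_of_nonneg fun _ _ => abs_nonneg _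

theorem sqNorm_sub_le_of_l1Norm_le {b bhat : Fin m → ℝ} (h : l1Norm bhat ≤ l1Norm b) :
    sqNorm (b - bhat) ≤ 4 * (m * sqNorm b) := by
  have h1 : l1Norm (b - bhat) ≤ l1Norm b + l1Norm bhat := by
    rw [l1Norm, l1Norm, l1Norm, ← Finset.sum_add_distrib]
    exact Finset.sum_le_sum fun i _ => abs_sub _ _
  have h2 : l1Norm b ^ 2 ≤ m * sqNorm b := by
    simpa [l1Norm, sqNorm] using sum_abs_sq_le Finset.univ b
  calc sqNorm (b - bhat) ≤ l1Norm (b - bhat) ^ 2 := sqNorm_le_l1Norm_sq _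
    _ ≤ (2 * l1Norm b) ^ 2 := pow_le_pow_left₀ (l1Norm_nonneg _) (by linarith) 2
    _ ≤ _ := by rw [mul_pow]; linarith

omit [IsProbabilityMeasure μ] in
/-- The error is square integrable whatever the restricted isometry constants are, because the
output of the selector has at most the `ℓ¹` norm of the residual. -/
theorem Model.integrable_error (hm : Model A σobs σsys Smax Sfa N μ x ν y w T) (k : ℕ)
    {βhat : Ω → Fin m → ℝ} (hβ : AEMeasurable βhat μ)
    (hsel : ∀ᵐ ω ∂μ, IsDantzigSelector A (lam m * σobs) (yRes A y T (k + 1) ω) (βhat ω)) :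
    Integrable (fun ω => sqNorm (resid A x y T (k + 1) ω - βhat ω)) μ := by
  have hdom : Integrable (fun ω => 4 * (m * sqNorm (resid A x y T (k + 1) ω))) μ :=
    ((integrable_finsetSum _ fun i _ => (hm.resid_memLp k i).integrable_sq).const_mul _).const_mul _
  refine hdom.mono' ?_ ?_
  · have hr : AEMeasurable (resid A x y T (k + 1)) μ :=
      aemeasurable_pi_lambda _ fun i => (hm.resid_memLp k i).aemeasurable
    have hs : Measurable fun v : Fin m → ℝ => sqNorm v := by unfold sqNorm; fun_prop
    exact (hs.comp_aemeasurable (hr.sub hβ)).aestronglyMeasurable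
  · filter_upwards [hsel, hm.ae_resid_feasible k] with ω h1 h2
    rw [Real.norm_of_nonneg (sqNorm_nonneg _)]
    exact sqNorm_sub_le_of_l1Norm_le (h1.2 _ h2)

theorem Model.condExp_error_le (hm : Model A σobs σsys Smax Sfa N μ x ν y w T) (k : ℕ)
    {βhat : Ω → Fin m → ℝ} (hβ : AEMeasurable βhat μ)
    (hsel : ∀ᵐ ω ∂μ, IsDantzigSelector A (lam m * σobs) (yRes A y T (k + 1) ω) (βhat ω))
    {S : ℕ} (hS : S ∈ Finset.Icc 1 (SInfty A)) {U : Finset (Fin m)}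
    (hU : ricDelta A U.card < 1) :
    ∀ᵐ ω ∂μ, T k ω = U →
      (μ[fun ω => sqNorm (resid A x y T (k + 1) ω - βhat ω) | obsSigma y k]) ω
        ≤ BCSLSE A σobs U.card (N (k + 1) \ U).card (condSqUndet N μ x y T (k + 1) ω) S := by
  have hS0 : 0 < S := (Finset.mem_Icc.1 hS).1
  obtain ⟨F, E, hF, hEcard, hE, hL⟩ := hm.exists_index_set k hU S
  set d := (N (k + 1) \ U).card
  set c := C3 A S * (((U.card + d - S : ℕ) : ℝ) / S) with hc
  have hc0 : 0 ≤ c := mul_nonneg (C3_nonneg A S) (by positivity)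
  have hEint : Integrable (fun ω => ∑ i ∈ E, residOn A x y (k + 1) U ω i ^ 2) μ :=
    integrable_finsetSum _ fun i _ => hm.integrable_residOn_sq k U i
  have hconst : Integrable (fun _ : Ω => C2 A S * S * σobs ^ 2) μ := integrable_const _
  have hpoint : ∀ᵐ ω ∂μ, ω ∈ {ω | T k ω = U} → sqNorm (resid A x y T (k + 1) ω - βhat ω)
      ≤ ((fun _ : Ω => C2 A S * S * σobs ^ 2)
        + c • fun ω => ∑ i ∈ E, residOn A x y (k + 1) U ω i ^ 2 : Ω → ℝ) ω := by
    filter_upwards [hsel, hm.ae_resid_feasible k, hm.x_eq_zero (k + 1)] with ω h1 h2 h3 hω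
    have hω' : T k ω = U := hω
    have hres : resid A x y T (k + 1) ω = residOn A x y (k + 1) U ω := by rw [← hω']; rfl
    refine (sqNorm_sub_dantzig_le A hS0 (incoherence_of_le_SInfty A hS) hm.σobs_nonneg h2 h1 F
      hF).trans ?_
    simp only [Pi.add_apply, Pi.smul_apply, smul_eq_mul]
    refine add_le_add le_rfl ?_
    rw [hc, mul_assoc]
    refine mul_le_mul_of_nonneg_left ?_ (C3_nonneg A S)
    rw [div_mul_eq_mul_div]
    refine div_le_div_of_nonneg_right ?_ (Nat.cast_nonneg S)
    rw [← hEcard, hres]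
    refine le_trans (pow_le_pow_left₀ (Finset.sum_nonneg fun _ _ => abs_nonneg _) ?_ 2)
      (sum_abs_sq_le E _)
    -- the entries off `F` that are not in `E` vanish
    calc ∑ i ∈ Fᶜ, |residOn A x y (k + 1) U ω i|
        = ∑ i ∈ Fᶜ ∩ E, |residOn A x y (k + 1) U ω i| := by
          refine (Finset.sum_subset Finset.inter_subset_left fun i hi hiE => ?_).symm
          have hiF : i ∉ F := Finset.mem_compl.1 hi
          have hnot : i ∉ U ∪ N (k + 1) := fun h =>
            hiE (Finset.mem_inter.2 ⟨hi, hE i hiF h⟩)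
          rw [Finset.mem_union, not_or] at hnot
          rw [residOn_of_notMem _ hnot.1, h3 i hnot.2, abs_zero]
      _ ≤ _ := Finset.sum_le_sum_of_subset_of_nonneg Finset.inter_subset_right
          fun _ _ _ => abs_nonneg _
  have hund : ∀ᵐ ω ∂μ, ω ∈ {ω | T k ω = U} → condSqUndet N μ x y T (k + 1) ω
      = (μ[fun ω => ∑ i ∈ N (k + 1) \ U, x (k + 1) ω i ^ 2 | obsSigma y k]) ω := by
    have hind : (fun ω => ∑ i ∈ undet N T (k + 1) ω, x (k + 1) ω i ^ 2)
        = fun ω => ∑ V, {ω | T k ω = V}.indicator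
            (fun ω => ∑ i ∈ N (k + 1) \ V, x (k + 1) ω i ^ 2) ω := by
      ext ω
      rw [Finset.sum_eq_single (T k ω)]
      · rw [Set.indicator_of_mem (by rfl)]; rfl
      · intro V _ hV
        exact Set.indicator_of_notMem (fun h => hV h.symm) _
      · simp
    have hxi : ∀ B : Finset (Fin m), Integrable (fun ω => ∑ i ∈ B, x (k + 1) ω i ^ 2) μ :=
      fun B => integrable_finsetSum _ fun i _ => (hm.x_memLp (k + 1) i).integrable_sq
    refine condExp_eq_condExp_on ?_ (hxi _) (hm.obsSigma_le k) (hm.T_adapted k U)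
      (ae_of_all _ fun ω hω => ?_)
    · rw [hind]
      exact integrable_finsetSum _ fun V _ => (hxi _).indicator (hm.measurableSet_eq k V)
    · have hω' : T k ω = U := hω
      rw [← hω']; rfl
  have hmono := condExp_le_condExp_on (hm.integrable_error k hβ hsel) (hconst.add (hEint.smul c))
    (hm.obsSigma_le k) (hm.T_adapted k U) hpoint
  filter_upwards [hmono, hund, hL, condExp_add hconst (hEint.smul c) (obsSigma y k),
    condExp_smul (μ := μ) c (fun ω => ∑ i ∈ E, residOn A x y (k + 1) U ω i ^ 2) (obsSigma y k)]
    with ω h1 h2 h3 h4 h5 hω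
  rw [h2 hω]
  refine (h1 hω).trans ?_
  rw [h4, Pi.add_apply, h5, condExp_const (hm.obsSigma_le k), BCSLSE, ← hc]
  exact add_le_add le_rfl (mul_le_mul_of_nonneg_left h3 hc0)

end Model

end LSCS
end

theorem theorem1 {m n : ℕ} (A : Matrix (Fin n) (Fin m) ℝ) (σobs σsys : ℝ) (Smax Sfa : ℕ)
    (N : ℕ → Finset (Fin m)) {Ω : Type*} [MeasurableSpace Ω] (μ : Measure Ω)
    [IsProbabilityMeasure μ]
    (x ν : ℕ → Ω → Fin m → ℝ) (y w : ℕ → Ω → Fin n → ℝ) (T : ℕ → Ω → Finset (Fin m))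
    (hmodel : LSCS.Model A σobs σsys Smax Sfa N μ x ν y w T)
    (t : ℕ) (ht : 1 ≤ t) :
    -- all the second moments involved are finite
    ((∀ i, Integrable (fun ω => x t ω i ^ 2) μ) ∧
      (∀ i, Integrable (fun ω => LSCS.resid A x y T t ω i ^ 2) μ)) ∧
    -- compressibility of the residual signal
    (∀ᵐ ω ∂μ,
      LSCS.threshold A σobs N μ x y T t ω < ((t : ℝ) - LSCS.lastAdd N t + 1) * σsys ^ 2 →
        LSCS.CompressibleAt A N μ x y T t ω) ∧
    (∀ᵐ ω ∂μ,
      LSCS.threshold A σobs N μ x y T t ω ≤ ((t : ℝ) - LSCS.lastAdd N t + 1) * σsys ^ 2 →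
        LSCS.WeaklyCompressibleAt A N μ x y T t ω) ∧
    -- error bound for the Dantzig selector applied to the residual
    (∀ βhat : Ω → Fin m → ℝ, AEMeasurable βhat μ →
      (∀ᵐ ω ∂μ,
        LSCS.IsDantzigSelector A (LSCS.lam m * σobs) (LSCS.yRes A y T t ω) (βhat ω)) →
      Integrable (fun ω => LSCS.sqNorm (x t ω - (LSCS.xTmp A y T t ω + βhat ω))) μ ∧
      ∀ᵐ ω ∂μ, ∀ S ∈ Finset.Icc 1 (LSCS.SInfty A),
        (μ[fun ω' => LSCS.sqNorm (x t ω' - (LSCS.xTmp A y T t ω' + βhat ω'))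
            | LSCS.obsSigma y (t - 1)]) ω
          ≤ LSCS.BCSLSE A σobs (T (t - 1) ω).card (LSCS.undet N T t ω).card
              (LSCS.condSqUndet N μ x y T t ω) S) := by
  obtain ⟨k, rfl⟩ : ∃ k, t = k + 1 := ⟨t - 1, by omega⟩
  have hthr := hmodel.condSqResid_le_threshold k
  refine ⟨⟨fun i => (hmodel.x_memLp _ i).integrable_sq,
    fun i => (hmodel.resid_memLp k i).integrable_sq⟩, ?_, ?_, ?_⟩
  · filter_upwards [hthr] with ω h1 h2 i hi j hj
    exact (h1 i hi).trans_lt (h2.trans_le (hmodel.le_integral_x_sq ht hj))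
  · filter_upwards [hthr] with ω h1 h2 i hi j hj
    exact (h1 i hi).trans (h2.trans (hmodel.le_integral_x_sq ht hj))
  · intro βhat hβ hsel
    have hsub : (fun ω => LSCS.sqNorm (x (k + 1) ω - (LSCS.xTmp A y T (k + 1) ω + βhat ω)))
        = fun ω => LSCS.sqNorm (LSCS.resid A x y T (k + 1) ω - βhat ω) := by
      ext ω
      rw [LSCS.resid, sub_sub]
    rw [hsub]
    refine ⟨hmodel.integrable_error k hβ hsel, ?_⟩
    have hall : ∀ᵐ ω ∂μ, ∀ (U : Finset (Fin m)) (S : ℕ), LSCS.ricDelta A U.card < 1 →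
        S ∈ Finset.Icc 1 (LSCS.SInfty A) → T k ω = U → _ :=
      ae_all_iff.2 fun U => ae_all_iff.2 fun S =>
        Filter.eventually_imp_distrib_left.2 fun hU =>
          Filter.eventually_imp_distrib_left.2 fun hS =>
            hmodel.condExp_error_le k hβ hsel hS hU
    filter_upwards [hall, hmodel.ae_ricDelta_lt k] with ω h1 h2 S hS
    exact h1 (T k ω) S h2 hS rfl
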